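/- **Setting.** A *T-algebra of rank $r$* is a finite-dimensional real, not necessarily associative, algebra $\mathcal A$ with a direct sum decomposition into subspaces $\mathcal A=\bigoplus_{i,j=1}^r\mathcal A_{ij}$ (write $a=\sum_{i,j} a_{ij}$ with $a_{ij}\in\mathcal A_{ij}$) such that $\mathcal A_{ij}\mathcal A_{jk}\subseteq\mathcal A_{ik}$ and $\mathcal A_{ij}\mathcal A_{kl}=\{0\}$ for $j\ne k$, and with a linear involution $a\mapsto a^*$ satisfying $a^{**}=a$, $(ab)^*=b^*a^*$, $\mathcal A_{ij}^*=\mathcal A_{ji}$, such that: 1. for each $i$ there is an algebra isomorphism $\rho_i:\mathcal A_{ii}\to\mathbb R$; put $e_i=\rho_i^{-1}(1)$ and $\operatorname{tr}a=\sum_i\rho_i(a_{ii})$; 2. $e_ia_{ij}=a_{ij}$ and $a_{ji}e_i=a_{ji}$ for all $a,i,j$; 3. $\operatorname{tr}(ab)=\operatorname{tr}(ba)$; 4. $\operatorname{tr}((ab)c)=\operatorname{tr}(a(bc))$; 5. $\operatorname{tr}(aa^*)\ge 0$, with equality if and only if $a=0$; 6. $a_{ij}(b_{jk}c_{kl})=(a_{ij}b_{jk})c_{kl}$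 for all $a,b,c\in\mathcal A$ and $i\le j\le k\le l$; 7. $a_{ij}(b_{jk}b_{lk}^*)=(a_{ij}b_{jk})b_{lk}^*$ for all $a,b\in\mathcal A$, $i\le j\le k$ and $l\le k$, where $b_{lk}^*=(b_{lk})^*$. Let $\mathcal H=\{a\in\mathcal A: a^*=a\}$. Call $t\in\mathcal A$ upper triangular if $t_{ij}=0$ for $j<i$, and let $\mathcal T_+$ (resp. $\mathcal T_{++}$) be the set of upper triangular $t$ with $\rho_i(t_{ii})\ge 0$ (resp. $>0$) for all $i$. Let $\mathcal K(\mathcal A)=\{tt^*: t\in\mathcal T_{++}\}\subseteq\mathcal H$, with closure $\operatorname{cl}\mathcal K(\mathcal A)$. An element $t\in\mathcal T_+$ is *proper* if $t_{ii}=0$ implies $t_{ki}=0$ for all $k<i$. For a set $K$ in a finite-dimensional real space $E$, $\operatorname{Aut}(K)$ is the group of linear bijections $Q$ of $E$ with $Q(K)=K$. For $a\in\mathcal A$ define the linear map $Q_a:\mathcal H\to\mathcal H$ by $Q_a(b)=\tfrac12(c+c^*)$, where $c=a(ba^*)+a(ab)-(aa)b$. A *triangular automorphism* of $\mathcal K(\mathcal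 A)$ is an element of $\operatorname{Aut}(\mathcal K(\mathcal A))$ of the form $Q_u$ with $u\in\mathcal T_{++}$. For $I\subseteq\{1,\dots,r\}$ let $\mathcal A_I=\{a\in\mathcal A: a_{ik}=a_{ki}=0 \text{ for all } i\in I \text{ and all } k\}$, which is a T-algebra of rank $r-|I|$ with the inherited structure (remaining indices in their original order), and let $\mathcal K(\mathcal A_I)\subseteq\mathcal H$ be its cone. That is, $\mathcal K(\mathcal A_I)$ is the set of all $tt^*$ with $t\in\mathcal A_I$ upper triangular and $\rho_i(t_{ii})>0$ for all $i\notin I$. A convex cone is a set closed under addition and under multiplication by positive scalars. A *face* of a convex cone $C$ is a nonempty convex cone $\mathcal F\subseteq C$ such that $x,y\in C$ and $x+y\in\mathcal F$ imply $x,y\in\mathcal F$; it is *proper* if $\mathcal F\ne C$, and *projectionally exposed* if $\mathcal F=P(C)$ for some linear $P:E\to E$ with $P^2=P$. A convex cone $K$ is *homogeneous* if $\operatorname{Aut}(K)$ acts transitively on its relative interior $\operatorname{ri}K$. A homogeneous cone $K$ with $K\neq\emptyset$ and pointed closure has *rank $s$* if there is a T-algebra $\mathcal B$ of rank $s$ and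 a linear isomorphism $\operatorname{span}K\to\mathcal H(\mathcal B)$ mapping $\operatorname{ri}K$ onto $\mathcal K(\mathcal B)$, and every T-algebra with this property has rank $s$. **Theorem.** Let $\mathcal A$ be a T-algebra of rank $r$ and let $\mathcal F$ be a proper face of $\operatorname{cl}\mathcal K(\mathcal A)$. Then: (i) $\mathcal F$ is projectionally exposed. (ii) $\mathcal F$ is a homogeneous cone of some rank $s<r$, and there are a nonempty $I\subseteq\{1,\dots,r\}$ and a triangular automorphism $Q_u$ of $\mathcal K(\mathcal A)$ with $Q_u(\mathcal F)=\operatorname{cl}\mathcal K(\mathcal A_I)$. Furthermore, every $x\in\operatorname{ri}\mathcal F$ can be written as $x=tt^*$ for exactly one proper $t\in\mathcal T_+$, and for this $t$ we have $I=\{i:\rho_i(t_{ii})=0\}$; moreover $s=r-|I|$. (iii) There is a subgroup $\mathcal G$ of the automorphism group of $\mathcal F$ (the linear bijections $g$ of $\operatorname{span}\mathcal F$ with $g(\mathcal F)=\mathcal F$) which acts simply transitively on $\operatorname{ri}\mathcal F$, and each $g\in\mathcal G$ is the restriction to $\operatorname{span}\mathcal F$ of a triangular automorphism of $\mathcal K(\mathcal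 A)$. -/

import Mathlib

universe u

noncomputable section

/-! ## Convex cones, faces, automorphisms -/

section Cones

variable {E : Type u} [AddCommGroup E] [Module ℝ E]

/-- A convex cone: a set closed under addition and under multiplication by positive scalars. -/
structure IsConvexCone (K : Set E) : Prop where
  add_mem : ∀ x ∈ K, ∀ y ∈ K, x + y ∈ K
  smul_mem : ∀ c : ℝ, 0 < c → ∀ x ∈ K, c • x ∈ K

/-- `F` is a (nonempty) face of `K`: a nonempty convex cone `F ⊆ K` such that `x, y ∈ K` and
`x + y ∈ F` imply `x, y ∈ F`. -/
structure IsConeFace (F K : Set E) : Prop where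
  subset : F ⊆ K
  nonempty : F.Nonempty
  isConvexCone : IsConvexCone F
  mem_of_add_mem : ∀ x ∈ K, ∀ y ∈ K, x + y ∈ F → x ∈ F ∧ y ∈ F

/-- `F` is projectionally exposed in `K`: `F` is the image of `K` under a linear projection of the
ambient space. -/
def IsProjectionallyExposed (F K : Set E) : Prop :=
  ∃ P : E →ₗ[ℝ] E, P '' K = F ∧ P ∘ₗ P = P

/-- The automorphism group of `K`: the linear bijections `Q` of the ambient space with
`Q(K) = K`. -/
def coneAut (K : Set E) : Subgroup (E ≃ₗ[ℝ] E) where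
  carrier := {Q | Q '' K = K}
  one_mem' := by
    change (fun x : E => x) '' K = K
    simp
  mul_mem' := by
    intro P Q hP hQ
    change (fun x : E => P (Q x)) '' K = K
    rw [← Set.image_image (fun x => P x) (fun x => Q x) K]
    exact (congrArg (fun S => P '' S) hQ).trans hP
  inv_mem' := by
    intro Q hQ
    change (fun x : E => Q.symm x) '' K = K
    have hQ' : Q '' K = K := hQ
    conv_lhs => rw [← hQ']
    rw [Set.image_image]
    simp

/-- A homogeneous cone: a convex cone whose automorphism group acts transitively on its relative
interior. -/
structure IsHomogeneousCone [TopologicalSpace E] (K : Set E) : Prop where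
  isConvexCone : IsConvexCone K
  transitive : ∀ x ∈ intrinsicInterior ℝ K, ∀ y ∈ intrinsicInterior ℝ K, ∃ Q ∈ coneAut K, Q x = y

end Cones

/-! ## T-algebras -/

/-- A matrix algebra of rank `r`: a (not necessarily associative) real algebra with a bigradation
`A = ⨁ᵢⱼ Aᵢⱼ`, `1 ≤ i, j ≤ r`, such that `Aᵢⱼ Aⱼₖ ⊆ Aᵢₖ` and `Aᵢⱼ Aₖₗ = 0` for `j ≠ k`. -/
structure BigradedAlgebra (r : ℕ) (A : Type u) [AddCommGroup A] [Module ℝ A] where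
  /-- the bilinear product -/
  mul : A →ₗ[ℝ] A →ₗ[ℝ] A
  /-- the subspaces `Aᵢⱼ` -/
  grade : Fin r → Fin r → Submodule ℝ A
  isInternal : DirectSum.IsInternal fun p : Fin r × Fin r => grade p.1 p.2
  mul_mem : ∀ i j k, ∀ a ∈ grade i j, ∀ b ∈ grade j k, mul a b ∈ grade i k
  mul_eq_zero : ∀ i j k l, j ≠ k → ∀ a ∈ grade i j, ∀ b ∈ grade k l, mul a b = 0

/-- The component `aᵢⱼ ∈ Aᵢⱼ` of `a` in the decomposition `a = ∑ᵢⱼ aᵢⱼ`, as a linear map in `a`. -/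
def BigradedAlgebra.comp {r : ℕ} {A : Type u} [AddCommGroup A] [Module ℝ A]
    (T : BigradedAlgebra r A) (i j : Fin r) : A →ₗ[ℝ] T.grade i j :=
  DirectSum.component ℝ (Fin r × Fin r) (fun p => T.grade p.1 p.2) (i, j) ∘ₗ
    (LinearEquiv.ofBijective
      (DirectSum.coeLinearMap fun p : Fin r × Fin r => T.grade p.1 p.2) T.isInternal).symm

/-- A matrix algebra of rank `r` with an involution, all of whose diagonal blocks `Aᵢᵢ` are
identified with `ℝ` by an algebra isomorphism `ρᵢ`. -/
structure InvolutiveBigradedAlgebra (r : ℕ) (A : Type u) [AddCommGroup A] [Module ℝ A]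
    extends BigradedAlgebra r A where
  /-- the involution `a ↦ a*` -/
  invol : A →ₗ[ℝ] A
  invol_invol : ∀ a, invol (invol a) = a
  invol_mul : ∀ a b, invol (mul a b) = mul (invol b) (invol a)
  invol_grade : ∀ i j, (grade i j).map invol = grade j i
  /-- the isomorphism `ρᵢ` from `Aᵢᵢ` to `ℝ` -/
  rho : ∀ i, grade i i ≃ₗ[ℝ] ℝ
  rho_mul : ∀ i (a b : grade i i),
    rho i ⟨mul a b, mul_mem i i i a a.2 b b.2⟩ = rho i a * rho i b

namespace InvolutiveBigradedAlgebra

variable {r : ℕ} {A : Type u} [AddCommGroup A] [Module ℝ A] (T : InvolutiveBigradedAlgebra r A)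

/-- The unit `eᵢ` of `Aᵢᵢ`, i.e. the element with `ρᵢ(eᵢ) = 1`. -/
def unit (i : Fin r) : A := ((T.rho i).symm 1 : T.grade i i)

/-- The number `ρᵢ(aᵢᵢ)`. -/
def diag (a : A) (i : Fin r) : ℝ := T.rho i (T.comp i i a)

/-- The trace `tr a = ∑ᵢ ρᵢ(aᵢᵢ)`. -/
def trace (a : A) : ℝ := ∑ i, T.diag a i

end InvolutiveBigradedAlgebra

/-- A T-algebra of rank `r`. -/
structure TAlgebra (r : ℕ) (A : Type u) [AddCommGroup A] [Module ℝ A]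
    extends InvolutiveBigradedAlgebra r A where
  unit_mul : ∀ i j, ∀ a ∈ grade i j, mul (toInvolutiveBigradedAlgebra.unit i) a = a
  mul_unit : ∀ i j, ∀ a ∈ grade j i, mul a (toInvolutiveBigradedAlgebra.unit i) = a
  trace_mul_comm : ∀ a b, toInvolutiveBigradedAlgebra.trace (mul a b) =
    toInvolutiveBigradedAlgebra.trace (mul b a)
  trace_mul_assoc : ∀ a b c, toInvolutiveBigradedAlgebra.trace (mul (mul a b) c) =
    toInvolutiveBigradedAlgebra.trace (mul a (mul b c))
  trace_mul_invol_nonneg : ∀ a, 0 ≤ toInvolutiveBigradedAlgebra.trace (mul a (invol a))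
  trace_mul_invol_eq_zero : ∀ a, toInvolutiveBigradedAlgebra.trace (mul a (invol a)) = 0 ↔ a = 0
  /-- `aᵢⱼ (bⱼₖ cₖₗ) = (aᵢⱼ bⱼₖ) cₖₗ` for `i ≤ j ≤ k ≤ l` -/
  mul_assoc_upper : ∀ (a b c : A) (i j k l : Fin r), i ≤ j → j ≤ k → k ≤ l →
    mul (toBigradedAlgebra.comp i j a)
        (mul (toBigradedAlgebra.comp j k b) (toBigradedAlgebra.comp k l c)) =
      mul (mul (toBigradedAlgebra.comp i j a) (toBigradedAlgebra.comp j k b))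
        (toBigradedAlgebra.comp k l c)
  /-- `aᵢⱼ (bⱼₖ bₗₖ*) = (aᵢⱼ bⱼₖ) bₗₖ*` for `i ≤ j ≤ k` and `l ≤ k`, with the same `b` twice -/
  mul_assoc_invol : ∀ (a b : A) (i j k l : Fin r), i ≤ j → j ≤ k → l ≤ k →
    mul (toBigradedAlgebra.comp i j a)
        (mul (toBigradedAlgebra.comp j k b) (invol (toBigradedAlgebra.comp l k b))) =
      mul (mul (toBigradedAlgebra.comp i j a) (toBigradedAlgebra.comp j k b))
        (invol (toBigradedAlgebra.comp l k b))

namespace TAlgebra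

section Algebraic

variable {r : ℕ} {A : Type u} [AddCommGroup A] [Module ℝ A] (T : TAlgebra r A)

/-- The space `H(A)` of Hermitian elements, `a* = a`. -/
def herm : Submodule ℝ A where
  carrier := {a | T.invol a = a}
  add_mem' := by
    intro a b ha hb
    change T.invol (a + b) = a + b
    rw [map_add, show T.invol a = a from ha, show T.invol b = b from hb]
  zero_mem' := map_zero T.invol
  smul_mem' := by
    intro c a ha
    change T.invol (c • a) = c • a
    rw [map_smul, show T.invol a = a from ha]

/-- Upper triangular elements: `aᵢⱼ = 0` for `j < i`. -/
def UT : Set A := {a | ∀ i j, j < i → T.comp i j a = 0}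

/-- Upper triangular elements with nonnegative diagonal. -/
def UTp : Set A := {a | a ∈ T.UT ∧ ∀ i, 0 ≤ T.diag a i}

/-- Upper triangular elements with positive diagonal. -/
def UTpp : Set A := {a | a ∈ T.UT ∧ ∀ i, 0 < T.diag a i}

/-- `t` is proper: `t` is upper triangular with nonnegative diagonal, and `tᵢᵢ = 0` implies that
the whole `i`-th column of `t` vanishes. -/
def IsProper (t : A) : Prop :=
  t ∈ T.UTp ∧ ∀ i, T.comp i i t = 0 → ∀ k, k < i → T.comp k i t = 0

/-- The homogeneous cone `K(A) = {t t* | t ∈ UT₊₊}`, a subset of `H(A)`. -/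
def cone : Set T.herm := {x | ∃ t ∈ T.UTpp, (x : A) = T.mul t (T.invol t)}

/-- The principal subalgebra `A_I`: the elements all of whose rows and columns with index in `I`
vanish. -/
def principalSubalgebra (I : Finset (Fin r)) : Submodule ℝ A where
  carrier := {a | ∀ i ∈ I, ∀ k, T.comp i k a = 0 ∧ T.comp k i a = 0}
  add_mem' := by
    intro a b ha hb i hi k
    rw [map_add, map_add, (ha i hi k).1, (ha i hi k).2, (hb i hi k).1, (hb i hi k).2]
    simp
  zero_mem' := by
    intro i _ k
    simp
  smul_mem' := by
    intro c a ha i hi k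
    rw [map_smul, map_smul, (ha i hi k).1, (ha i hi k).2]
    simp

/-- The homogeneous cone `K(A_I)` of the principal subalgebra `A_I`, regarded as a subset of `H(A)`.
The T-algebra `A_I` of rank `r - |I|` has the product, involution and `ρᵢ` of `A` and the blocks
`Aᵢⱼ` with `i, j ∉ I`, in the order inherited from `A`; so `UT₊₊(A_I)` consists of the upper
triangular `t ∈ A_I` with `ρᵢ(tᵢᵢ) > 0` for all `i ∉ I`. -/
def principalCone (I : Finset (Fin r)) : Set T.herm :=
  {x | ∃ t ∈ T.principalSubalgebra I, t ∈ T.UT ∧ (∀ i ∉ I, 0 < T.diag t i) ∧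
    (x : A) = T.mul t (T.invol t)}

/-- The map `c ↦ c_H = c + c*`, with values in `H(A)`. -/
def hermPart : A →ₗ[ℝ] T.herm :=
  LinearMap.codRestrict T.herm (LinearMap.id + T.invol) (by
    intro c
    change T.invol (c + T.invol c) = c + T.invol c
    rw [map_add, T.invol_invol, add_comm])

/-- The quadratic map `Q_a : H(A) → H(A)`, `Q_a(b) = ½ (a(b a*) + a(a b) - (a a) b)_H`. -/
def quad (a : A) : T.herm →ₗ[ℝ] T.herm :=
  (1 / 2 : ℝ) • (T.hermPart ∘ₗ
    (T.mul a ∘ₗ T.mul.flip (T.invol a) + T.mul a ∘ₗ T.mul a - T.mul (T.mul a a)) ∘ₗ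
      T.herm.subtype)

/-- A triangular automorphism of `K(A)`: an automorphism of `K(A)` of the form `Q_u`,
`u ∈ UT₊₊`. -/
def IsTriangularAut (Q : T.herm ≃ₗ[ℝ] T.herm) : Prop :=
  Q ∈ coneAut T.cone ∧ ∃ u ∈ T.UTpp, (Q : T.herm →ₗ[ℝ] T.herm) = T.quad u

end Algebraic

end TAlgebra

/-! ## The rank of a homogeneous cone -/

/-- The relative interior of `K`, inside the linear span of `K`, is linearly isomorphic to the cone
of some (finite-dimensional) T-algebra of rank `s`. -/
def IsConeOfTAlgebraOfRank {E : Type u} [AddCommGroup E] [Module ℝ E] [TopologicalSpace E]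
    (K : Set E) (s : ℕ) : Prop :=
  ∃ (B : Type u) (_ : AddCommGroup B) (_ : Module ℝ B) (_ : FiniteDimensional ℝ B)
    (S : TAlgebra s B) (φ : Submodule.span ℝ K ≃ₗ[ℝ] S.herm),
      φ '' {x | (x : E) ∈ intrinsicInterior ℝ K} = S.cone

/-- The (pointed) homogeneous cone `K` has rank `s`: the T-algebras whose cone is linearly
isomorphic to the relative interior of `K` exist, and they all have rank `s`. -/
def HasHomogeneousRank {E : Type u} [AddCommGroup E] [Module ℝ E] [TopologicalSpace E]
    (K : Set E) (s : ℕ) : Prop :=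
  IsConeOfTAlgebraOfRank K s ∧ ∀ s', IsConeOfTAlgebraOfRank K s' → s' = s

end

/-!
Triangular elements multiply associatively and satisfy `u (t t*) = (u t) t*`. Polarizing the
second identity gives `Q_u (t t*) = (u t)(u t)*` (`TAlgebra.quad_sq`), so that `u ↦ Q_u` is a
representation on `H(A)` of the monoid of triangular elements, and the group of triangular
elements with positive diagonal acts on the cone by triangular automorphisms.

The closed cone is the set of all `t t*` with `t` triangular. Gaussian elimination
(`TAlgebra.exists_rotate`, `TAlgebra.exists_isProper_add`) shows that it is closed under addition
and that each of its elements has a proper factor, which is unique (`TAlgebra.proper_unique`).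

Relative interiors of convex cones are handled through order units, an algebraic notion that every
linear bijection transports (`mem_intrinsicInterior_iff_isOrderUnit`). An order unit of the
coordinate face of `I ⊆ {1, …, r}`, which is the closure of the cone of `A_I`, has a factor with
no further zero on the diagonal: otherwise some nonnegative functional `tr Q_u`, not zero on the
face, would vanish at it. The group of triangular elements fixing the indices in `I` is simply
transitive on such factors, hence all of them give order units
(`TAlgebra.isOrderUnit_coordFace_iff`).

Given a face `F`, let `t t*` be in its relative interior with `t` proper, and let `I` be the set
of zeros on the diagonal of `t`. Some `u` in the triangular group maps `t` to the idempotent `e =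
∑_{i ∉ I} eᵢ`, and `Q_u F` is the face generated by `e`, which is the coordinate face of `I`
(`TAlgebra.exists_image_face_eq`). All assertions are transported from there: the projection is
`Q_e`, the group is the triangular group of `A_I`, and the proper factors are the images under
`u⁻¹` of the proper factors in `A_I`. Finally, the rank of a T-algebra is determined by its cone,
because it is the length of the longest chain of faces of the closed cone
(`TAlgebra.rank_unique`).
-/

noncomputable section

/-! ### Components in a bigraded algebra -/

namespace BigradedAlgebra

variable {r : ℕ} {A : Type u} [AddCommGroup A] [Module ℝ A] (T : BigradedAlgebra r A)

theorem sum_coe_comp (a : A) : ∑ p : Fin r × Fin r, (T.comp p.1 p.2 a : A) = a := by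
  classical
  let e := LinearEquiv.ofBijective
      (DirectSum.coeLinearMap fun p : Fin r × Fin r => T.grade p.1 p.2) T.isInternal
  have h : e (e.symm a) = a := e.apply_symm_apply a
  conv_rhs => rw [← h]
  change _ = DirectSum.coeLinearMap (fun p : Fin r × Fin r => T.grade p.1 p.2) (e.symm a)
  rw [DirectSum.coeLinearMap_eq_dfinsuppSum, DFinsupp.sum_eq_sum_fintype]
  · rfl
  · intro i; simp

theorem symm_apply_of_mem {i j : Fin r} {a : A} (ha : a ∈ T.grade i j) :
    (LinearEquiv.ofBijective
      (DirectSum.coeLinearMap fun p : Fin r × Fin r => T.grade p.1 p.2) T.isInternal).symm a =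
        DirectSum.lof ℝ (Fin r × Fin r) (fun p => T.grade p.1 p.2) (i, j) ⟨a, ha⟩ := by
  rw [LinearEquiv.symm_apply_eq]
  exact (DirectSum.coeLinearMap_lof (fun p : Fin r × Fin r => T.grade p.1 p.2) (i, j)
    ⟨a, ha⟩).symm

theorem coe_comp_of_mem {i j : Fin r} {a : A} (ha : a ∈ T.grade i j) :
    (T.comp i j a : A) = a := by
  have : T.comp i j a = ⟨a, ha⟩ := by
    unfold comp
    simp only [LinearMap.comp_apply, LinearEquiv.coe_coe, T.symm_apply_of_mem ha]
    exact DirectSum.component.lof_self ℝ (M := fun p : Fin r × Fin r => T.grade p.1 p.2) (i, j) _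
  rw [this]

theorem coe_comp_of_mem_of_ne {i j k l : Fin r} {a : A} (ha : a ∈ T.grade i j)
    (h : (i, j) ≠ (k, l)) : (T.comp k l a : A) = 0 := by
  have : T.comp k l a = 0 := by
    unfold comp
    simp only [LinearMap.comp_apply, LinearEquiv.coe_coe, T.symm_apply_of_mem ha]
    rw [DirectSum.component.of]
    simp [h]
  rw [this]; rfl

end BigradedAlgebra

namespace TAlgebra

/-! ### The Peirce decomposition with respect to the units -/

section Peirce

variable {r : ℕ} {A : Type u} [AddCommGroup A] [Module ℝ A] (T : TAlgebra r A)

local notation:70 a:70 " ⋆ " b:71 => T.mul a b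

/-- The block `aᵢⱼ` of `a`, regarded as an element of `A`. -/
def block (i j : Fin r) : A →ₗ[ℝ] A := (T.grade i j).subtype ∘ₗ T.comp i j

theorem block_mem (i j : Fin r) (a : A) : T.block i j a ∈ T.grade i j := (T.comp i j a).2

theorem coe_comp (i j : Fin r) (a : A) : (T.comp i j a : A) = T.block i j a := rfl

theorem comp_eq_zero_iff (i j : Fin r) (a : A) : T.comp i j a = 0 ↔ T.block i j a = 0 := by
  rw [← coe_comp, ZeroMemClass.coe_eq_zero]

theorem sum_block (a : A) : ∑ p : Fin r × Fin r, T.block p.1 p.2 a = a := T.sum_coe_comp a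

theorem block_of_mem {i j : Fin r} {a : A} (ha : a ∈ T.grade i j) : T.block i j a = a :=
  T.coe_comp_of_mem ha

theorem block_of_mem_of_ne {i j k l : Fin r} {a : A} (ha : a ∈ T.grade i j)
    (h : (i, j) ≠ (k, l)) : T.block k l a = 0 :=
  T.coe_comp_of_mem_of_ne ha h

theorem grade_induction {P : A → Prop} (hg : ∀ i j, ∀ a ∈ T.grade i j, P a)
    (hadd : ∀ a b, P a → P b → P (a + b)) (h0 : P 0) (a : A) : P a := by
  rw [← T.sum_block a]
  exact Finset.sum_induction _ _ hadd h0 fun p _ => hg p.1 p.2 _ (T.block_mem _ _ _)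

theorem unit_mem (i : Fin r) : T.unit i ∈ T.grade i i := ((T.rho i).symm 1).2

theorem invol_mem {i j : Fin r} {a : A} (ha : a ∈ T.grade i j) : T.invol a ∈ T.grade j i := by
  rw [← T.invol_grade i j]; exact Submodule.mem_map_of_mem ha

@[simp]
theorem invol_unit (i : Fin r) : T.invol (T.unit i) = T.unit i := by
  have h := T.unit_mul i i _ (T.invol_mem (T.unit_mem i))
  have h2 := congrArg T.invol h
  rw [T.invol_mul, T.invol_invol, h] at h2
  exact h2

theorem unit_mul_of_ne {i j k : Fin r} (h : i ≠ j) {a : A} (ha : a ∈ T.grade j k) :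
    T.unit i ⋆ a = 0 :=
  T.mul_eq_zero i i j k h _ (T.unit_mem i) _ ha

theorem mul_unit_of_ne {i j k : Fin r} (h : j ≠ i) {a : A} (ha : a ∈ T.grade k j) :
    a ⋆ T.unit i = 0 :=
  T.mul_eq_zero k j i i h _ ha _ (T.unit_mem i)

/-- Although `A` is not associative, three factors may be re-bracketed as soon as one of them is
some `eᵢ`; this lemma and the next two cover the three positions. -/
theorem unit_mul_mul (i : Fin r) (a b : A) : T.unit i ⋆ (a ⋆ b) = (T.unit i ⋆ a) ⋆ b := by
  revert b
  refine T.grade_induction (P := fun a => ∀ b, T.unit i ⋆ (a ⋆ b) = (T.unit i ⋆ a) ⋆ b)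
    (fun k l a ha b => ?_) (fun a a' h h' b => ?_) (by simp) a
  · refine T.grade_induction (P := fun b => T.unit i ⋆ (a ⋆ b) = (T.unit i ⋆ a) ⋆ b)
      (fun m n b hb => ?_) (fun b b' h h' => by simp only [map_add, h, h']) (by simp) b
    by_cases hik : i = k
    · subst hik
      rw [T.unit_mul i l a ha]
      by_cases hlm : l = m
      · subst hlm
        rw [T.unit_mul i n _ (T.mul_mem i l n a ha b hb)]
      · rw [T.mul_eq_zero i l m n hlm a ha b hb, map_zero]
    · rw [T.unit_mul_of_ne hik ha]
      by_cases hlm : l = m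
      · subst hlm
        rw [T.unit_mul_of_ne hik (T.mul_mem k l n a ha b hb)]; simp
      · rw [T.mul_eq_zero k l m n hlm a ha b hb]; simp
  · simp only [map_add, LinearMap.add_apply, h, h']

theorem mul_mul_unit (i : Fin r) (a b : A) : (a ⋆ b) ⋆ T.unit i = a ⋆ (b ⋆ T.unit i) := by
  have h := congrArg T.invol (T.unit_mul_mul i (T.invol b) (T.invol a))
  simpa only [T.invol_mul, T.invol_invol, T.invol_unit] using h

theorem mul_unit_mul (i : Fin r) (a b : A) : (a ⋆ T.unit i) ⋆ b = a ⋆ (T.unit i ⋆ b) := by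
  revert b
  refine T.grade_induction (P := fun a => ∀ b, (a ⋆ T.unit i) ⋆ b = a ⋆ (T.unit i ⋆ b))
    (fun k l a ha b => ?_) (fun a a' h h' b => ?_) (by simp) a
  · refine T.grade_induction (P := fun b => (a ⋆ T.unit i) ⋆ b = a ⋆ (T.unit i ⋆ b))
      (fun m n b hb => ?_) (fun b b' h h' => by simp only [map_add, h, h']) (by simp) b
    by_cases hli : l = i
    · subst hli
      rw [T.mul_unit l k a ha]
      by_cases hlm : l = m
      · subst hlm
        rw [T.unit_mul l n b hb]
      · rw [T.unit_mul_of_ne hlm hb, T.mul_eq_zero k l m n hlm a ha b hb, map_zero]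
    · rw [T.mul_unit_of_ne hli ha]
      by_cases him : i = m
      · subst him
        rw [T.unit_mul i n b hb, T.mul_eq_zero k l i n hli a ha b hb]; simp
      · rw [T.unit_mul_of_ne him hb]; simp
  · simp only [map_add, LinearMap.add_apply, h, h']

theorem block_eq (i j : Fin r) (a : A) : T.block i j a = (T.unit i ⋆ a) ⋆ T.unit j := by
  refine T.grade_induction (P := fun a => T.block i j a = (T.unit i ⋆ a) ⋆ T.unit j)
    (fun k l a ha => ?_) (fun a b h h' => by simp only [map_add, LinearMap.add_apply, h, h'])
    (by simp) a
  by_cases hik : i = k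
  · subst hik
    rw [T.unit_mul i l a ha]
    by_cases hlj : l = j
    · subst hlj
      rw [T.mul_unit l i a ha, T.block_of_mem ha]
    · rw [T.mul_unit_of_ne hlj ha, T.block_of_mem_of_ne ha (by simp [hlj])]
  · rw [T.unit_mul_of_ne hik ha, T.block_of_mem_of_ne ha (by simp [Ne.symm hik])]; simp

theorem unit_mul_unit_self (i : Fin r) : T.unit i ⋆ T.unit i = T.unit i :=
  T.unit_mul i i _ (T.unit_mem i)

theorem unit_mul_unit_of_ne {i j : Fin r} (h : i ≠ j) : T.unit i ⋆ T.unit j = 0 :=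
  T.unit_mul_of_ne h (T.unit_mem j)

theorem diag_smul_unit (a : A) (i : Fin r) : T.diag a i • T.unit i = T.block i i a := by
  have : T.comp i i a = T.diag a i • (T.rho i).symm 1 := by
    apply (T.rho i).injective
    rw [map_smul, LinearEquiv.apply_symm_apply, smul_eq_mul, mul_one]
    rfl
  rw [← coe_comp, this]; rfl

theorem diag_eq_of_block {a : A} {i : Fin r} {c : ℝ} (h : T.block i i a = c • T.unit i) :
    T.diag a i = c := by
  have : T.comp i i a = c • (T.rho i).symm 1 := Subtype.ext h
  unfold InvolutiveBigradedAlgebra.diag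
  rw [this, map_smul, LinearEquiv.apply_symm_apply, smul_eq_mul, mul_one]

theorem diag_eq_zero_iff (a : A) (i : Fin r) : T.diag a i = 0 ↔ T.block i i a = 0 := by
  constructor
  · intro h; rw [← diag_smul_unit, h, zero_smul]
  · intro h; exact T.diag_eq_of_block (by rw [h, zero_smul])

theorem diag_add (a b : A) (i : Fin r) : T.diag (a + b) i = T.diag a i + T.diag b i := by
  simp [InvolutiveBigradedAlgebra.diag]

theorem diag_smul (c : ℝ) (a : A) (i : Fin r) : T.diag (c • a) i = c * T.diag a i := by
  simp [InvolutiveBigradedAlgebra.diag]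

theorem diag_zero (i : Fin r) : T.diag 0 i = 0 := by
  simp [InvolutiveBigradedAlgebra.diag]

theorem diag_unit_self (i : Fin r) : T.diag (T.unit i) i = 1 :=
  T.diag_eq_of_block (by rw [T.block_of_mem (T.unit_mem i), one_smul])

theorem diag_unit_of_ne {i j : Fin r} (h : i ≠ j) : T.diag (T.unit i) j = 0 := by
  rw [T.diag_eq_zero_iff, T.block_of_mem_of_ne (T.unit_mem i) (by simp [h])]

theorem trace_smul_unit (c : ℝ) (i : Fin r) : T.trace (c • T.unit i) = c := by
  unfold InvolutiveBigradedAlgebra.trace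
  rw [Finset.sum_eq_single i]
  · rw [diag_smul, diag_unit_self, mul_one]
  · intro j _ h; rw [diag_smul, T.diag_unit_of_ne h.symm, mul_zero]
  · simp

/-- The idempotent `∑_{i ∈ J} eᵢ`. For `J = Finset.univ` it is the unit element of `A`. -/
def idem (J : Finset (Fin r)) : A := ∑ i ∈ J, T.unit i

theorem sum_unit_mul (a : A) : ∑ i, T.unit i ⋆ a = a := by
  refine T.grade_induction (P := fun a => ∑ i, T.unit i ⋆ a = a)
    (fun k l a ha => ?_)
    (fun a b h h' => by simp only [map_add, Finset.sum_add_distrib, h, h']) (by simp) a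
  rw [Finset.sum_eq_single k]
  · exact T.unit_mul k l a ha
  · intro j _ h; exact T.unit_mul_of_ne h ha
  · simp

theorem sum_mul_unit (a : A) : ∑ i, a ⋆ T.unit i = a := by
  have := congrArg T.invol (T.sum_unit_mul (T.invol a))
  simpa only [map_sum, T.invol_mul, T.invol_invol, invol_unit] using this

theorem ext_block {a b : A} (h : ∀ i j, T.block i j a = T.block i j b) : a = b := by
  rw [← T.sum_block a, ← T.sum_block b]
  exact Finset.sum_congr rfl fun p _ => h _ _

theorem ext_col {a b : A} (h : ∀ i, a ⋆ T.unit i = b ⋆ T.unit i) : a = b := by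
  rw [← T.sum_mul_unit a, ← T.sum_mul_unit b]
  exact Finset.sum_congr rfl fun p _ => h _

theorem ext_row {a b : A} (h : ∀ i, T.unit i ⋆ a = T.unit i ⋆ b) : a = b := by
  rw [← T.sum_unit_mul a, ← T.sum_unit_mul b]
  exact Finset.sum_congr rfl fun p _ => h _

theorem block_invol (i j : Fin r) (a : A) : T.block i j (T.invol a) = T.invol (T.block j i a) := by
  rw [block_eq, block_eq, T.invol_mul, T.invol_mul, T.invol_unit, T.invol_unit, mul_mul_unit,
    T.unit_mul_mul]

theorem diag_mul_invol (a : A) (i : Fin r) :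
    T.diag (a ⋆ T.invol a) i = T.trace ((T.unit i ⋆ a) ⋆ T.invol (T.unit i ⋆ a)) := by
  have h : (T.unit i ⋆ a) ⋆ T.invol (T.unit i ⋆ a) = T.diag (a ⋆ T.invol a) i • T.unit i := by
    rw [diag_smul_unit, block_eq, T.invol_mul, T.invol_unit, T.unit_mul_mul, T.mul_mul_unit]
  rw [h, trace_smul_unit]

theorem diag_mul_invol_nonneg (a : A) (i : Fin r) : 0 ≤ T.diag (a ⋆ T.invol a) i := by
  rw [diag_mul_invol]; exact T.trace_mul_invol_nonneg _

theorem diag_mul_invol_eq_zero_iff (a : A) (i : Fin r) :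
    T.diag (a ⋆ T.invol a) i = 0 ↔ T.unit i ⋆ a = 0 := by
  rw [diag_mul_invol]; exact T.trace_mul_invol_eq_zero _

/-! ### Idempotents -/

theorem idem_univ_mul (a : A) : T.idem Finset.univ ⋆ a = a := by
  simpa [idem, LinearMap.sum_apply] using T.sum_unit_mul a

theorem mul_idem_univ (a : A) : a ⋆ T.idem Finset.univ = a := by
  simpa [idem] using T.sum_mul_unit a

@[simp]
theorem invol_idem (J : Finset (Fin r)) : T.invol (T.idem J) = T.idem J := by
  simp [idem]

theorem unit_mul_idem (J : Finset (Fin r)) (i : Fin r) :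
    T.unit i ⋆ T.idem J = if i ∈ J then T.unit i else 0 := by
  classical
  unfold idem
  rw [map_sum]
  split_ifs with h
  · rw [Finset.sum_eq_single_of_mem i h fun j _ hj => T.unit_mul_unit_of_ne hj.symm,
      unit_mul_unit_self]
  · exact Finset.sum_eq_zero fun j hj => T.unit_mul_unit_of_ne (fun e => h (e ▸ hj))

theorem idem_mul_unit (J : Finset (Fin r)) (i : Fin r) :
    T.idem J ⋆ T.unit i = if i ∈ J then T.unit i else 0 := by
  have := congrArg T.invol (T.unit_mul_idem J i)
  rw [T.invol_mul, invol_idem, invol_unit] at this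
  rw [this]; split_ifs <;> simp

theorem unit_mul_idem_mul (J : Finset (Fin r)) (i : Fin r) (a : A) :
    T.unit i ⋆ (T.idem J ⋆ a) = if i ∈ J then T.unit i ⋆ a else 0 := by
  rw [unit_mul_mul, unit_mul_idem]; split_ifs <;> simp

theorem mul_idem_mul_unit (J : Finset (Fin r)) (i : Fin r) (a : A) :
    (a ⋆ T.idem J) ⋆ T.unit i = if i ∈ J then a ⋆ T.unit i else 0 := by
  rw [mul_mul_unit, idem_mul_unit]; split_ifs <;> simp

theorem idem_mul_mul (J : Finset (Fin r)) (a b : A) :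
    T.idem J ⋆ (a ⋆ b) = (T.idem J ⋆ a) ⋆ b := by
  simp only [idem, map_sum, LinearMap.sum_apply, unit_mul_mul]

theorem mul_mul_idem (J : Finset (Fin r)) (a b : A) :
    (a ⋆ b) ⋆ T.idem J = a ⋆ (b ⋆ T.idem J) := by
  simp only [idem, map_sum, mul_mul_unit]

theorem mul_idem_eq_self {J : Finset (Fin r)} {a : A} (h : ∀ i ∉ J, a ⋆ T.unit i = 0) :
    a ⋆ T.idem J = a := by
  refine T.ext_col fun i => ?_
  rw [mul_idem_mul_unit]
  split_ifs with hi
  · rfl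
  · exact (h i hi).symm

theorem idem_mul_eq_self {J : Finset (Fin r)} {a : A} (h : ∀ i ∉ J, T.unit i ⋆ a = 0) :
    T.idem J ⋆ a = a := by
  refine T.ext_row fun i => ?_
  rw [unit_mul_idem_mul]
  split_ifs with hi
  · rfl
  · exact (h i hi).symm

theorem diag_idem (J : Finset (Fin r)) (i : Fin r) :
    T.diag (T.idem J) i = if i ∈ J then 1 else 0 := by
  apply T.diag_eq_of_block
  rw [block_eq, unit_mul_idem]; split_ifs <;> simp [unit_mul_unit_self]

end Peirce
end TAlgebra

namespace TAlgebra

/-! ### Upper triangular elements -/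

section Triangular

variable {r : ℕ} {A : Type u} [AddCommGroup A] [Module ℝ A] (T : TAlgebra r A)

local notation:70 a:70 " ⋆ " b:71 => T.mul a b

theorem mem_UT_iff {a : A} : a ∈ T.UT ↔ ∀ i j, j < i → T.block i j a = 0 :=
  forall₃_congr fun i j _ => T.comp_eq_zero_iff i j a

/-- The upper triangular elements as a subspace. -/
def upper : Submodule ℝ A where
  carrier := T.UT
  add_mem' := by
    intro a b ha hb i j h
    rw [map_add, ha i j h, hb i j h, add_zero]
  zero_mem' := by intro i j _; rw [map_zero]
  smul_mem' := by
    intro c a ha i j h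
    rw [map_smul, ha i j h, smul_zero]

theorem mem_upper_iff {a : A} : a ∈ T.upper ↔ ∀ i j, j < i → T.block i j a = 0 := T.mem_UT_iff

theorem unit_mem_upper (i : Fin r) : T.unit i ∈ T.upper := by
  rw [mem_upper_iff]
  intro k l h
  refine T.block_of_mem_of_ne (T.unit_mem i) fun e => ?_
  simp only [Prod.mk.injEq] at e
  omega

theorem idem_mem_upper (J : Finset (Fin r)) : T.idem J ∈ T.upper :=
  T.upper.sum_mem fun i _ => T.unit_mem_upper i

theorem block_mul (i j : Fin r) (a b : A) :
    T.block i j (a ⋆ b) = ∑ k, T.block i k a ⋆ T.block k j b := by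
  rw [block_eq, unit_mul_mul, mul_mul_unit]
  conv_lhs => rw [← T.sum_mul_unit (T.unit i ⋆ a)]
  rw [map_sum, LinearMap.sum_apply]
  refine Finset.sum_congr rfl fun k _ => ?_
  rw [block_eq, block_eq, T.mul_mul_unit j (T.unit k) b, ← T.mul_unit_mul k (_ ⋆ _) (_ ⋆ _),
    T.mul_mul_unit k (T.unit i ⋆ a), unit_mul_unit_self]

theorem mul_mem_upper {a b : A} (ha : a ∈ T.upper) (hb : b ∈ T.upper) : a ⋆ b ∈ T.upper := by
  rw [mem_upper_iff] at *
  intro i j hij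
  rw [block_mul]
  refine Finset.sum_eq_zero fun k _ => ?_
  rcases lt_or_ge k i with h | h
  · rw [ha i k h]; simp
  · rw [hb k j (lt_of_lt_of_le hij h)]; simp

theorem diag_mul {a b : A} (ha : a ∈ T.upper) (hb : b ∈ T.upper) (i : Fin r) :
    T.diag (a ⋆ b) i = T.diag a i * T.diag b i := by
  rw [mem_upper_iff] at *
  apply T.diag_eq_of_block
  rw [block_mul, Finset.sum_eq_single i]
  · rw [← diag_smul_unit, ← diag_smul_unit]
    simp only [map_smul, LinearMap.smul_apply, unit_mul_unit_self, smul_smul]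
    rw [mul_comm]
  · intro k _ hk
    rcases lt_or_gt_of_ne hk with h | h
    · rw [ha i k h]; simp
    · rw [hb k i h]; simp
  · simp

theorem upper_assoc {a b c : A} (ha : a ∈ T.upper) (hb : b ∈ T.upper) (hc : c ∈ T.upper) :
    (a ⋆ b) ⋆ c = a ⋆ (b ⋆ c) := by
  rw [mem_upper_iff] at *
  have key : ∀ p q s : Fin r × Fin r, (T.block p.1 p.2 a ⋆ T.block q.1 q.2 b) ⋆ T.block s.1 s.2 c =
      T.block p.1 p.2 a ⋆ (T.block q.1 q.2 b ⋆ T.block s.1 s.2 c) := by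
    rintro ⟨i, j⟩ ⟨j', k⟩ ⟨k', l⟩
    dsimp only
    have hA := T.block_mem i j a
    have hB := T.block_mem j' k b
    have hC := T.block_mem k' l c
    by_cases hk : k = k'
    · subst hk
      by_cases hj : j = j'
      · subst hj
        rcases lt_or_ge j i with h1 | h1
        · rw [ha i j h1]; simp
        rcases lt_or_ge k j with h2 | h2
        · rw [hb j k h2]; simp
        rcases lt_or_ge l k with h3 | h3
        · rw [hc k l h3]; simp
        exact (T.mul_assoc_upper a b c i j k l h1 h2 h3).symm
      · rw [T.mul_eq_zero i j j' k hj _ hA _ hB,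
          T.mul_eq_zero i j j' l hj _ hA _ (T.mul_mem j' k l _ hB _ hC)]
        simp
    · rw [T.mul_eq_zero j' k k' l hk _ hB _ hC, map_zero]
      by_cases hj : j = j'
      · subst hj
        rw [T.mul_eq_zero i k k' l hk _ (T.mul_mem i j k _ hA _ hB) _ hC]
      · rw [T.mul_eq_zero i j j' k hj _ hA _ hB]; simp
  conv_lhs => rw [← T.sum_block a, ← T.sum_block b, ← T.sum_block c]
  conv_rhs => rw [← T.sum_block a, ← T.sum_block b, ← T.sum_block c]
  simp only [map_sum, LinearMap.sum_apply, key]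

/-- The blockwise axiom `aᵢⱼ (bⱼₖ bₗₖ*) = (aᵢⱼ bⱼₖ) bₗₖ*`, summed over all blocks. The remaining
triples of blocks vanish on both sides. -/
theorem mul_mul_invol {a b : A} (ha : a ∈ T.upper) (hb : b ∈ T.upper) :
    (a ⋆ b) ⋆ T.invol b = a ⋆ (b ⋆ T.invol b) := by
  rw [mem_upper_iff] at *
  have key : ∀ p q s : Fin r × Fin r,
      (T.block p.1 p.2 a ⋆ T.block q.1 q.2 b) ⋆ T.invol (T.block s.1 s.2 b) =
      T.block p.1 p.2 a ⋆ (T.block q.1 q.2 b ⋆ T.invol (T.block s.1 s.2 b)) := by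
    rintro ⟨i, j⟩ ⟨j', k⟩ ⟨l, k'⟩
    dsimp only
    have hA := T.block_mem i j a
    have hB := T.block_mem j' k b
    have hC := T.invol_mem (T.block_mem l k' b)
    by_cases hk : k = k'
    · subst hk
      by_cases hj : j = j'
      · subst hj
        rcases lt_or_ge j i with h1 | h1
        · rw [ha i j h1]; simp
        rcases lt_or_ge k j with h2 | h2
        · rw [hb j k h2]; simp
        rcases lt_or_ge k l with h3 | h3
        · rw [hb l k h3]; simp
        exact (T.mul_assoc_invol a b i j k l h1 h2 h3).symm
      · rw [T.mul_eq_zero i j j' k hj _ hA _ hB,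
          T.mul_eq_zero i j j' l hj _ hA _ (T.mul_mem j' k l _ hB _ hC)]
        simp
    · rw [T.mul_eq_zero j' k k' l hk _ hB _ hC, map_zero]
      by_cases hj : j = j'
      · subst hj
        rw [T.mul_eq_zero i k k' l hk _ (T.mul_mem i j k _ hA _ hB) _ hC]
      · rw [T.mul_eq_zero i j j' k hj _ hA _ hB]; simp
  conv_lhs => rw [← T.sum_block a, ← T.sum_block b]
  conv_rhs => rw [← T.sum_block a, ← T.sum_block b]
  simp only [map_sum, LinearMap.sum_apply, key]

/-- The polarization of `mul_mul_invol`. -/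
theorem mul_mul_invol_add {a b c : A} (ha : a ∈ T.upper) (hb : b ∈ T.upper) (hc : c ∈ T.upper) :
    (a ⋆ b) ⋆ T.invol c + (a ⋆ c) ⋆ T.invol b = a ⋆ (b ⋆ T.invol c) + a ⋆ (c ⋆ T.invol b) := by
  have h := T.mul_mul_invol ha (add_mem hb hc)
  simp only [map_add, LinearMap.add_apply] at h
  have h1 := T.mul_mul_invol ha hb
  have h2 := T.mul_mul_invol ha hc
  rw [h1, h2] at h
  rw [← sub_eq_zero] at h ⊢
  rw [← h]; abel

/-! ### The quadratic maps on squares of triangular elements -/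

/-- The Hermitian square `t t*`. -/
def sq (t : A) : T.herm :=
  ⟨t ⋆ T.invol t, by
    change T.invol (t ⋆ T.invol t) = t ⋆ T.invol t
    rw [T.invol_mul, T.invol_invol]⟩

theorem coe_sq (t : A) : (T.sq t : A) = t ⋆ T.invol t := rfl

theorem invol_herm (x : T.herm) : T.invol x = x := x.2

theorem coe_quad (a : A) (x : T.herm) : (T.quad a x : A) =
    (1 / 2 : ℝ) • ((a ⋆ (x ⋆ T.invol a) + a ⋆ (a ⋆ x) - (a ⋆ a) ⋆ x) +
      T.invol (a ⋆ (x ⋆ T.invol a) + a ⋆ (a ⋆ x) - (a ⋆ a) ⋆ x)) := by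
  simp [quad, hermPart]

/-- The quadratic map realizes left multiplication of triangular factors: `Q_a (t t*) = (a t)(a
t)*`. After re-bracketing, the nonassociative error terms in the definition of `Q_a` are the two
sides of the polarized identity for `a, at, t`. -/
theorem quad_sq {a t : A} (ha : a ∈ T.upper) (ht : t ∈ T.upper) :
    T.quad a (T.sq t) = T.sq (a ⋆ t) := by
  have hat := T.mul_mem_upper ha ht
  have h1 : (t ⋆ T.invol t) ⋆ T.invol a = t ⋆ T.invol (a ⋆ t) := by
    have := congrArg T.invol (T.mul_mul_invol ha ht)
    rw [T.invol_mul (a ⋆ t), T.invol_invol, T.invol_mul a (t ⋆ _), T.invol_mul t,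
      T.invol_invol] at this
    exact this.symm
  have h2 : (a ⋆ a) ⋆ (t ⋆ T.invol t) = (a ⋆ (a ⋆ t)) ⋆ T.invol t := by
    rw [← T.mul_mul_invol (T.mul_mem_upper ha ha) ht, T.upper_assoc ha ha ht]
  have h3 : a ⋆ (a ⋆ (t ⋆ T.invol t)) = a ⋆ ((a ⋆ t) ⋆ T.invol t) := by
    rw [T.mul_mul_invol ha ht]
  have h4 := T.mul_mul_invol_add ha hat ht
  have h5 : a ⋆ ((t ⋆ T.invol t) ⋆ T.invol a) + a ⋆ (a ⋆ (t ⋆ T.invol t)) -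
      (a ⋆ a) ⋆ (t ⋆ T.invol t) = (a ⋆ t) ⋆ T.invol (a ⋆ t) := by
    rw [h1, h2, h3, sub_eq_iff_eq_add, add_comm, ← h4, add_comm]
  apply Subtype.ext
  rw [coe_quad, coe_sq, coe_sq, h5, T.invol_mul (a ⋆ t), T.invol_invol, ← two_smul ℝ, smul_smul]
  norm_num

/-- Every Hermitian element is `t + t*` for an upper triangular `t`. -/
theorem exists_add_invol (x : T.herm) : ∃ t ∈ T.upper, (x : A) = t + T.invol t := by
  let c : Fin r → Fin r → ℝ := fun i j => if i < j then 1 else if i = j then 1 / 2 else 0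
  refine ⟨∑ p : Fin r × Fin r, c p.1 p.2 • T.block p.1 p.2 x, ?_, ?_⟩
  · refine T.upper.sum_mem fun p _ => ?_
    rw [mem_upper_iff]
    intro i j hij
    rw [map_smul]
    by_cases h : p = (i, j)
    · subst h
      have : c i j = 0 := by simp only [c]; rw [if_neg (by omega), if_neg (by omega)]
      simp [this]
    · rw [T.block_of_mem_of_ne (T.block_mem p.1 p.2 x) h, smul_zero]
  · have h1 : T.invol (∑ p : Fin r × Fin r, c p.1 p.2 • T.block p.1 p.2 x) =
        ∑ p : Fin r × Fin r, c p.2 p.1 • T.block p.1 p.2 x := by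
      rw [map_sum, ← (Equiv.prodComm (Fin r) (Fin r)).sum_comp]
      refine Finset.sum_congr rfl fun p _ => ?_
      simp only [Equiv.prodComm_apply, Prod.fst_swap, Prod.snd_swap, map_smul, ← block_invol,
        invol_herm]
    rw [h1, ← Finset.sum_add_distrib]
    conv_lhs => rw [← T.sum_block (x : A)]
    refine Finset.sum_congr rfl fun p _ => ?_
    rw [← add_smul]
    have : c p.1 p.2 + c p.2 p.1 = 1 := by
      simp only [c]
      rcases lt_trichotomy p.1 p.2 with h | h | h
      · rw [if_pos h, if_neg (by omega), if_neg (by omega), add_zero]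
      · rw [h]; simp; norm_num
      · rw [if_neg (by omega), if_neg (by omega), if_pos h, zero_add]
    rw [this, one_smul]

/-- The squares of triangular elements span `H(A)`, by the polarization identity
`t + t* = (t + 1)(t + 1)* - t t* - 1`. -/
theorem span_sq : Submodule.span ℝ {x | ∃ t ∈ T.upper, x = T.sq t} = ⊤ := by
  rw [eq_top_iff]
  intro x _
  obtain ⟨t, ht, hx⟩ := T.exists_add_invol x
  have h1 := T.idem_mem_upper Finset.univ
  have : x = T.sq (t + T.idem Finset.univ) - T.sq t - T.sq (T.idem Finset.univ) := by
    apply Subtype.ext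
    simp only [AddSubgroupClass.coe_sub, coe_sq, map_add, LinearMap.add_apply, invol_idem,
      mul_idem_univ, idem_univ_mul, hx]
    abel
  rw [this]
  refine sub_mem (sub_mem ?_ ?_) ?_
  · exact Submodule.subset_span ⟨_, add_mem ht h1, rfl⟩
  · exact Submodule.subset_span ⟨_, ht, rfl⟩
  · exact Submodule.subset_span ⟨_, h1, rfl⟩

theorem quad_comp_quad {a b : A} (ha : a ∈ T.upper) (hb : b ∈ T.upper) :
    T.quad a ∘ₗ T.quad b = T.quad (a ⋆ b) := by
  refine LinearMap.ext_on T.span_sq ?_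
  rintro _ ⟨t, ht, rfl⟩
  rw [LinearMap.comp_apply, T.quad_sq hb ht, T.quad_sq ha (T.mul_mem_upper hb ht),
    T.quad_sq (T.mul_mem_upper ha hb) ht, T.upper_assoc ha hb ht]

theorem quad_quad {a b : A} (ha : a ∈ T.upper) (hb : b ∈ T.upper) (x : T.herm) :
    T.quad a (T.quad b x) = T.quad (a ⋆ b) x :=
  LinearMap.congr_fun (T.quad_comp_quad ha hb) x

theorem quad_one (x : T.herm) : T.quad (T.idem Finset.univ) x = x := by
  refine LinearMap.congr_fun (g := LinearMap.id) (LinearMap.ext_on T.span_sq ?_) x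
  rintro _ ⟨t, ht, rfl⟩
  rw [T.quad_sq (T.idem_mem_upper _) ht, idem_univ_mul]; rfl

/-! ### Inverses of triangular elements -/

theorem mem_UTpp_iff {a : A} : a ∈ T.UTpp ↔ a ∈ T.upper ∧ ∀ i, 0 < T.diag a i := Iff.rfl

theorem mul_mem_UTpp {a b : A} (ha : a ∈ T.UTpp) (hb : b ∈ T.UTpp) : a ⋆ b ∈ T.UTpp :=
  ⟨T.mul_mem_upper ha.1 hb.1, fun i => by
    rw [T.diag_mul ha.1 hb.1]; exact mul_pos (ha.2 i) (hb.2 i)⟩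

theorem one_mem_UTpp : T.idem Finset.univ ∈ T.UTpp :=
  ⟨T.idem_mem_upper _, fun i => by rw [diag_idem]; simp⟩

/-- Triangular back substitution, column by column. -/
theorem mul_right_cancel_zero {u t : A} (hu : u ∈ T.upper) (ht : t ∈ T.UTpp) (h : u ⋆ t = 0) :
    u = 0 := by
  have hu' := T.mem_upper_iff.1 hu
  have ht' := T.mem_upper_iff.1 ht.1
  refine T.ext_block fun i k => ?_
  rw [map_zero]
  induction k using WellFoundedLT.induction with
  | _ k ih =>
    have h2 : T.block i k (u ⋆ t) = 0 := by rw [h, map_zero]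
    rw [block_mul, Finset.sum_eq_single k] at h2
    · rw [← diag_smul_unit, map_smul, T.mul_unit _ _ _ (T.block_mem i k u)] at h2
      exact (smul_eq_zero.1 h2).resolve_left (ht.2 k).ne'
    · intro j _ hj
      rcases lt_or_gt_of_ne hj with h | h
      · rw [ih j h]; simp
      · rw [ht' j k h]; simp
    · simp

/-- Right multiplication by an upper triangular element, on upper triangular elements. -/
def mulRightUpper {t : A} (ht : t ∈ T.upper) : T.upper →ₗ[ℝ] T.upper :=
  (T.mul.flip t).restrict fun _ hu => T.mul_mem_upper hu ht

theorem mem_cone_iff {x : T.herm} : x ∈ T.cone ↔ ∃ t ∈ T.UTpp, x = T.sq t := by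
  simp only [cone, Set.mem_ofPred_eq, Subtype.ext_iff, coe_sq]

variable [FiniteDimensional ℝ A]

theorem exists_left_inv {t : A} (ht : t ∈ T.UTpp) :
    ∃ s ∈ T.UTpp, s ⋆ t = T.idem Finset.univ := by
  have hinj : Function.Injective (T.mulRightUpper ht.1) := by
    rw [injective_iff_map_eq_zero]
    intro u hu
    exact Subtype.ext (T.mul_right_cancel_zero u.2 ht (congrArg Subtype.val hu))
  obtain ⟨s, hs⟩ := LinearMap.surjective_of_injective hinj ⟨_, T.idem_mem_upper Finset.univ⟩
  have hs' : (s : A) ⋆ t = T.idem Finset.univ := congrArg Subtype.val hs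
  refine ⟨s, ⟨s.2, fun i => ?_⟩, hs'⟩
  have h := T.diag_mul s.2 ht.1 i
  rw [hs', diag_idem, if_pos (Finset.mem_univ _)] at h
  exact pos_of_mul_pos_left (h ▸ one_pos) (ht.2 i).le

/-- The triangular elements with positive diagonal form a group: left inverses exist because right
multiplication is injective, hence surjective, on the finite-dimensional space of triangular
elements. -/
theorem exists_inv {t : A} (ht : t ∈ T.UTpp) :
    ∃ s ∈ T.UTpp, s ⋆ t = T.idem Finset.univ ∧ t ⋆ s = T.idem Finset.univ := by
  obtain ⟨s, hs, hst⟩ := T.exists_left_inv ht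
  obtain ⟨w, hw, hws⟩ := T.exists_left_inv hs
  have : w = t := by
    rw [← T.mul_idem_univ w, ← hst, ← T.upper_assoc hw.1 hs.1 ht.1, hws, idem_univ_mul]
  exact ⟨s, hs, hst, this ▸ hws⟩

/-- A triangular element with a zero on the diagonal has a nonzero triangular left annihilator. -/
theorem exists_left_annihilator {t : A} (ht : t ∈ T.upper) {i : Fin r} (hi : T.diag t i = 0) :
    ∃ u ∈ T.upper, u ≠ 0 ∧ u ⋆ t = 0 := by
  by_contra! hcon
  have hinj : Function.Injective (T.mulRightUpper ht) := by
    rw [injective_iff_map_eq_zero]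
    intro u hu
    by_contra hne
    exact hcon u u.2 (fun h => hne (Subtype.ext h)) (congrArg Subtype.val hu)
  obtain ⟨s, hs⟩ := LinearMap.surjective_of_injective hinj ⟨_, T.idem_mem_upper Finset.univ⟩
  have hs' : (s : A) ⋆ t = T.idem Finset.univ := congrArg Subtype.val hs
  have h := T.diag_mul s.2 ht i
  rw [hs', diag_idem, if_pos (Finset.mem_univ _), hi, mul_zero] at h
  exact one_ne_zero h

/-- The linear automorphism `Q_u` of `H(A)`, for `u` in the group of triangular elements with
positive diagonal. -/
def quadEquiv (u : A) (hu : u ∈ T.UTpp) : T.herm ≃ₗ[ℝ] T.herm :=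
  LinearEquiv.ofBijective (T.quad u) (by
    obtain ⟨s, hs, hsu, hus⟩ := T.exists_inv hu
    refine Function.bijective_iff_has_inverse.2 ⟨T.quad s, fun x => ?_, fun x => ?_⟩
    · rw [T.quad_quad hs.1 hu.1, hsu, quad_one]
    · rw [T.quad_quad hu.1 hs.1, hus, quad_one])

@[simp]
theorem quadEquiv_apply (u : A) (hu : u ∈ T.UTpp) (x : T.herm) :
    T.quadEquiv u hu x = T.quad u x := rfl

theorem isTriangularAut_quadEquiv (u : A) (hu : u ∈ T.UTpp) :
    T.IsTriangularAut (T.quadEquiv u hu) := by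
  refine ⟨?_, u, hu, rfl⟩
  change T.quadEquiv u hu '' T.cone = T.cone
  apply Set.Subset.antisymm
  · rintro _ ⟨x, hx, rfl⟩
    obtain ⟨t, ht, rfl⟩ := T.mem_cone_iff.1 hx
    rw [quadEquiv_apply, T.quad_sq hu.1 ht.1]
    exact T.mem_cone_iff.2 ⟨_, T.mul_mem_UTpp hu ht, rfl⟩
  · intro x hx
    obtain ⟨t, ht, rfl⟩ := T.mem_cone_iff.1 hx
    obtain ⟨s, hs, hsu, hus⟩ := T.exists_inv hu
    refine ⟨T.sq (s ⋆ t), T.mem_cone_iff.2 ⟨_, T.mul_mem_UTpp hs ht, rfl⟩, ?_⟩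
    rw [quadEquiv_apply, T.quad_sq hu.1 (T.mul_mem_upper hs.1 ht.1),
      ← T.upper_assoc hu.1 hs.1 ht.1, hus, idem_univ_mul]

end Triangular
end TAlgebra

namespace TAlgebra

/-! ### Proper triangular factors -/

section Factorization

variable {r : ℕ} {A : Type u} [AddCommGroup A] [Module ℝ A] (T : TAlgebra r A)

local notation:70 a:70 " ⋆ " b:71 => T.mul a b

theorem isProper_iff {t : A} : T.IsProper t ↔
    t ∈ T.upper ∧ ∀ i, 0 ≤ T.diag t i ∧ (T.diag t i = 0 → t ⋆ T.unit i = 0) := by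
  constructor
  · rintro ⟨⟨h1, h2⟩, h3⟩
    refine ⟨h1, fun i => ⟨h2 i, fun h => T.ext_row fun k => ?_⟩⟩
    rw [unit_mul_mul, ← block_eq, map_zero]
    rcases lt_trichotomy k i with hk | hk | hk
    · exact (T.comp_eq_zero_iff _ _ _).1
        (h3 i ((T.comp_eq_zero_iff _ _ _).2 ((T.diag_eq_zero_iff t i).1 h)) k hk)
    · subst hk; exact (T.diag_eq_zero_iff t k).1 h
    · exact (T.mem_UT_iff.1 h1) k i hk
  · rintro ⟨h1, h2⟩
    refine ⟨⟨h1, fun i => (h2 i).1⟩, fun i hi k _ => ?_⟩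
    rw [comp_eq_zero_iff] at hi ⊢
    rw [block_eq, ← unit_mul_mul, (h2 i).2 ((T.diag_eq_zero_iff t i).2 hi), map_zero]

theorem IsProper.mem_upper {T : TAlgebra r A} {t : A} (h : T.IsProper t) : t ∈ T.upper := h.1.1

theorem IsProper.diag_nonneg {T : TAlgebra r A} {t : A} (h : T.IsProper t) (i : Fin r) :
    0 ≤ T.diag t i := h.1.2 i

theorem IsProper.mul_unit_eq_zero {T : TAlgebra r A} {t : A} (h : T.IsProper t) {i : Fin r}
    (hi : T.diag t i = 0) : T.mul t (T.unit i) = 0 := ((T.isProper_iff.1 h).2 i).2 hi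

theorem isProper_zero : T.IsProper 0 :=
  T.isProper_iff.2 ⟨zero_mem _, fun i => by simp [diag_zero]⟩

theorem isProper_mul {u t : A} (hu : u ∈ T.UTpp) (ht : T.IsProper t) : T.IsProper (u ⋆ t) := by
  refine T.isProper_iff.2 ⟨T.mul_mem_upper hu.1 ht.mem_upper, fun i => ?_⟩
  rw [T.diag_mul hu.1 ht.mem_upper]
  refine ⟨mul_nonneg (hu.2 i).le (ht.diag_nonneg i), fun h => ?_⟩
  rw [mul_mul_unit, ht.mul_unit_eq_zero ((mul_eq_zero.1 h).resolve_left (hu.2 i).ne'), map_zero]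

/-- `t t*` is the sum of the squares of the columns of `t`. -/
theorem sum_sq_col (t : A) :
    t ⋆ T.invol t = ∑ l, (t ⋆ T.unit l) ⋆ T.invol (t ⋆ T.unit l) := by
  conv_lhs => enter [1]; rw [← T.sum_mul_unit t]
  rw [map_sum, LinearMap.sum_apply]
  refine Finset.sum_congr rfl fun l _ => ?_
  rw [T.invol_mul, T.invol_unit, ← T.mul_unit_mul l (t ⋆ _), mul_mul_unit, unit_mul_unit_self]

/-- A Hermitian element has at most one proper factor: compare the columns from the last to the
first. -/
theorem proper_unique {t s : A} (ht : T.IsProper t) (hs : T.IsProper s)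
    (h : T.sq t = T.sq s) : t = s := by
  have h0 : t ⋆ T.invol t = s ⋆ T.invol s := congrArg Subtype.val h
  refine T.ext_col fun k => ?_
  induction k using WellFoundedGT.induction with
  | _ k ih =>
    -- The `k`-th column of `w w*` is `wₖₖ` times the `k`-th column of `w`, up to a term that
    -- depends only on later columns.
    have col : ∀ {w : A}, w ∈ T.upper → (w ⋆ T.invol w) ⋆ T.unit k = T.diag w k • (w ⋆ T.unit k) +
        ∑ l ∈ Finset.univ.filter (k < ·), (w ⋆ T.unit l) ⋆ T.invol (T.unit k ⋆ (w ⋆ T.unit l)) := by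
      intro w hw
      rw [sum_sq_col, map_sum, LinearMap.sum_apply, Finset.sum_filter,
        ← Finset.add_sum_erase _ _ (Finset.mem_univ k), ← Finset.add_sum_erase (Finset.univ)
          (fun l => if k < l then _ else _) (Finset.mem_univ k), if_neg (lt_irrefl k), zero_add]
      have hcol : ∀ l, ((w ⋆ T.unit l) ⋆ T.invol (w ⋆ T.unit l)) ⋆ T.unit k =
          (w ⋆ T.unit l) ⋆ T.invol (T.block k l w) := fun l => by
        rw [mul_mul_unit, block_eq, ← unit_mul_mul, T.invol_mul (T.unit k), invol_unit]
      congr 1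
      · rw [hcol, ← diag_smul_unit, map_smul, map_smul, invol_unit, mul_mul_unit,
          unit_mul_unit_self]
      · refine Finset.sum_congr rfl fun l hl => ?_
        rw [hcol]
        rcases lt_or_gt_of_ne (Finset.ne_of_mem_erase hl) with h | h
        · rw [T.mem_upper_iff.1 hw k l h, if_neg (by omega), map_zero, map_zero]
        · rw [if_pos h, block_eq, ← unit_mul_mul]
    have h1 := col ht.mem_upper
    rw [h0, col hs.mem_upper, Finset.sum_congr rfl (g := fun l =>
      (t ⋆ T.unit l) ⋆ T.invol (T.unit k ⋆ (t ⋆ T.unit l)))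
      (fun l hl => by rw [ih l (Finset.mem_filter.1 hl).2]), add_left_inj] at h1
    have h2 := congrArg (fun a => T.diag a k) h1
    simp only [diag_smul, T.diag_mul ht.mem_upper (T.unit_mem_upper k),
      T.diag_mul hs.mem_upper (T.unit_mem_upper k), diag_unit_self, mul_one] at h2
    have h3 : T.diag s k = T.diag t k :=
      (mul_self_inj (hs.diag_nonneg k) (ht.diag_nonneg k)).1 h2
    by_cases h4 : T.diag t k = 0
    · rw [ht.mul_unit_eq_zero h4, hs.mul_unit_eq_zero (h3.trans h4)]
    · rw [h3] at h1
      exact (smul_right_injective A h4 h1).symm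

/-- For `a` in column `j` and `p` the `j`-th row of `z`: `(a p) z* = a (z p*)*`. Only the `j`-th
row of `z` meets `a`, so that this is an instance of `a (z z*) = (a z) z*`. -/
theorem mul_row_mul_invol {a z : A} {j : Fin r} (ha : a ∈ T.upper) (haj : a ⋆ T.unit j = a)
    (hz : z ∈ T.upper) : (a ⋆ (T.unit j ⋆ z)) ⋆ T.invol z =
      a ⋆ T.invol (z ⋆ T.invol (T.unit j ⋆ z)) := by
  rw [← mul_unit_mul, haj, T.mul_mul_invol ha hz, T.invol_mul z, T.invol_invol, ← T.unit_mul_mul,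
    ← mul_unit_mul, haj]

/-- If `p p* = q eⱼ`, then `(a p)(a p)* = q a a*` for `a` in column `j`. In the polarized identity
for `a, p, ap` the two superfluous terms agree, since `a a = aⱼⱼ a`. -/
theorem sq_mul_row {a p : A} {j : Fin r} {q : ℝ} (ha : a ∈ T.upper) (haj : a ⋆ T.unit j = a)
    (hp : p ∈ T.upper) (hq : p ⋆ T.invol p = q • T.unit j) :
    (a ⋆ p) ⋆ T.invol (a ⋆ p) = q • (a ⋆ T.invol a) := by
  have hap := T.mul_mem_upper ha hp
  have haa : a ⋆ a = T.diag a j • a := by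
    have h : T.unit j ⋆ a = T.diag a j • T.unit j := by
      rw [diag_smul_unit, block_eq, ← unit_mul_mul, haj]
    conv_lhs => rw [← haj, mul_unit_mul, haj, h, map_smul, haj]
  have h1 : (a ⋆ p) ⋆ T.invol p = q • a := by
    rw [T.mul_mul_invol ha hp, hq, map_smul, haj]
  have h2 : p ⋆ T.invol (a ⋆ p) = q • T.invol a := by
    have := congrArg T.invol h1
    rwa [T.invol_mul, T.invol_invol, map_smul] at this
  have h3 := T.mul_mul_invol_add ha hp hap
  rw [h1, h2, ← T.upper_assoc ha ha hp, haa] at h3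
  simp only [map_smul, LinearMap.smul_apply, h1, haa] at h3
  rw [smul_comm] at h3
  exact add_right_cancel h3

/-- One elimination step. If `j` is the last nonzero row of `z`, then the column vector `c` and `z`
may be rotated into a column vector `c'` with positive diagonal entry and some `z'` whose `j`-th row
vanishes, without changing `c c* + z z*`. With `p = eⱼ z`, `v = z p*`, `p p* = q eⱼ` and
`ρ² = cⱼⱼ² + q`, one takes `c' = (cⱼⱼ c + v) / ρ` and
`z' = z - q⁻¹ (1 - cⱼⱼ / ρ) v p - ρ⁻¹ c p`. -/
theorem exists_rotate {c z : A} {j : Fin r} (hc : c ∈ T.upper) (hcj : c ⋆ T.unit j = c)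
    (hz : z ∈ T.upper) (hzj : ∀ i, j < i → T.unit i ⋆ z = 0)
    (hp0 : T.unit j ⋆ z ≠ 0) :
    ∃ c' ∈ T.upper, ∃ z' ∈ T.upper, c' ⋆ T.unit j = c' ∧ 0 < T.diag c' j ∧
      (∀ i, j ≤ i → T.unit i ⋆ z' = 0) ∧ T.sq c' + T.sq z' = T.sq c + T.sq z := by
  set p := T.unit j ⋆ z with hp
  set v := z ⋆ T.invol p with hv
  set q := T.diag (p ⋆ T.invol p) j with hq
  set σ := T.diag c j with hσ
  have hjp : T.unit j ⋆ p = p := by rw [hp, unit_mul_mul, unit_mul_unit_self]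
  have hpU : p ∈ T.upper := T.mul_mem_upper (T.unit_mem_upper j) hz
  have hpj : T.invol p ⋆ T.unit j = T.invol p := by
    conv_rhs => rw [← hjp, T.invol_mul, invol_unit]
  have hpp : p ⋆ T.invol p = q • T.unit j := by
    rw [hq, diag_smul_unit, block_eq, unit_mul_mul, hjp, mul_mul_unit, hpj]
  have hq0 : 0 < q := by
    refine lt_of_le_of_ne (T.diag_mul_invol_nonneg _ _) fun h => hp0 ?_
    have := (T.diag_mul_invol_eq_zero_iff p j).1 h.symm
    rwa [hjp] at this
  have hvj : v ⋆ T.unit j = v := by rw [hv, mul_mul_unit, hpj]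
  have hiv : ∀ i, j < i → T.unit i ⋆ v = 0 := fun i hi => by
    rw [hv, unit_mul_mul, hzj i hi]; simp
  have hic : ∀ i, j < i → T.unit i ⋆ c = 0 := fun i hi => by
    rw [← hcj, unit_mul_mul, ← block_eq]; exact T.mem_upper_iff.1 hc i j hi
  have hjv : T.unit j ⋆ v = q • T.unit j := by rw [hv, unit_mul_mul, ← hp, hpp]
  have hjc : T.unit j ⋆ c = σ • T.unit j := by
    rw [hσ, diag_smul_unit, block_eq, ← unit_mul_mul, hcj]
  have hvU : v ∈ T.upper := by
    rw [mem_upper_iff]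
    intro i k hki
    by_cases hjk : j = k
    · subst hjk; rw [block_eq, hiv i hki]; simp
    · rw [block_eq, ← unit_mul_mul, ← hvj, mul_mul_unit, T.unit_mul_unit_of_ne hjk, map_zero,
        map_zero]
  have hρ : 0 < σ ^ 2 + q := by positivity
  set β := (Real.sqrt (σ ^ 2 + q))⁻¹ with hβ
  have hβ0 : 0 < β := inv_pos.2 (Real.sqrt_pos.2 hρ)
  have hβ2 : β ^ 2 * (σ ^ 2 + q) = 1 := by
    rw [hβ, inv_pow, Real.sq_sqrt hρ.le]; exact inv_mul_cancel₀ hρ.ne'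
  set α := (1 - σ * β) / q with hα
  have hαq : α * q = 1 - σ * β := by rw [hα]; field_simp
  have hαβ : α * (1 + σ * β) = β ^ 2 := by
    rw [hα]; field_simp; linear_combination -hβ2
  have h1 : (v ⋆ p) ⋆ T.invol z = v ⋆ T.invol v := T.mul_row_mul_invol hvU hvj hz
  have h3 : (c ⋆ p) ⋆ T.invol z = c ⋆ T.invol v := T.mul_row_mul_invol hc hcj hz
  have h2 : z ⋆ T.invol (v ⋆ p) = v ⋆ T.invol v := by
    have := congrArg T.invol h1
    rwa [T.invol_mul (v ⋆ p), T.invol_invol, T.invol_mul v (T.invol v), T.invol_invol] at this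
  have h4 : z ⋆ T.invol (c ⋆ p) = v ⋆ T.invol c := by
    have := congrArg T.invol h3
    rwa [T.invol_mul (c ⋆ p), T.invol_invol, T.invol_mul c (T.invol v), T.invol_invol] at this
  have h5 := T.sq_mul_row hvU hvj hpU hpp
  have h6 := T.sq_mul_row hc hcj hpU hpp
  have h7 : (v ⋆ p) ⋆ T.invol (c ⋆ p) = q • (v ⋆ T.invol c) + q • (c ⋆ T.invol v) -
      (c ⋆ p) ⋆ T.invol (v ⋆ p) := by
    have := T.sq_mul_row (add_mem hvU hc) (by rw [map_add, LinearMap.add_apply, hvj, hcj])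
      hpU hpp
    simp only [map_add, LinearMap.add_apply, h5, h6, smul_add] at this
    rw [eq_sub_iff_add_eq]
    rw [← sub_eq_zero] at this ⊢
    rw [← this]; abel
  refine ⟨β • (σ • c + v), T.upper.smul_mem _ (add_mem (T.upper.smul_mem _ hc) hvU),
    z - α • (v ⋆ p) - β • (c ⋆ p), sub_mem (sub_mem hz (T.upper.smul_mem _
      (T.mul_mem_upper hvU hpU))) (T.upper.smul_mem _ (T.mul_mem_upper hc hpU)), ?_, ?_, ?_, ?_⟩
  · simp only [map_add, map_smul, LinearMap.add_apply, LinearMap.smul_apply, hvj, hcj]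
  · have : T.diag v j = q := T.diag_eq_of_block (by
      rw [block_eq, hjv, map_smul, LinearMap.smul_apply, unit_mul_unit_self])
    rw [diag_smul, diag_add, diag_smul, this]
    exact mul_pos hβ0 (add_pos_of_nonneg_of_pos (mul_self_nonneg σ) hq0)
  · intro i hi
    rcases hi.eq_or_lt with rfl | hi
    · simp only [map_sub, map_smul, unit_mul_mul, hjv, hjc, LinearMap.smul_apply, hjp, ← hp]
      match_scalars
      linear_combination -hαq
    · simp only [map_sub, map_smul, unit_mul_mul, hiv i hi, hic i hi, hzj i hi,
        LinearMap.map_zero₂, smul_zero, sub_zero]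
  · apply Subtype.ext
    simp only [Submodule.coe_add, coe_sq, map_add, map_sub, map_smul, LinearMap.add_apply,
      LinearMap.sub_apply, LinearMap.smul_apply, h1, h2, h3, h4, h5, h6, h7]
    match_scalars
    · linear_combination hβ2
    · linear_combination β * hαq
    · linear_combination β * hαq
    · linear_combination α * hαq - hαβ
    · rfl
    · ring

theorem sq_add_of_col {a b : A} {j : Fin r} (ha : a ⋆ T.unit j = 0) (hb : b ⋆ T.unit j = b) :
    T.sq (a + b) = T.sq a + T.sq b := by
  have h1 : a ⋆ T.invol b = 0 := by
    rw [← hb, T.invol_mul, invol_unit, ← mul_unit_mul, ha]; simp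
  have h2 : b ⋆ T.invol a = 0 := by
    rw [← hb, mul_unit_mul, ← T.invol_unit, ← T.invol_mul, ha]; simp
  apply Subtype.ext
  simp only [Submodule.coe_add, coe_sq, map_add, LinearMap.add_apply, h1, h2]
  abel

/-- Gaussian elimination: `s s* + z z*` has a proper factor. The rows of `z` are cleared one after
the other, starting from the last one. -/
theorem exists_isProper_add (m : ℕ) : ∀ {s z : A}, T.IsProper s → z ∈ T.upper →
    (∀ i : Fin r, m ≤ i → T.unit i ⋆ z = 0) → ∃ t, T.IsProper t ∧ T.sq t = T.sq s + T.sq z := by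
  induction m with
  | zero =>
    intro s z hs _ h
    have : z = 0 := T.ext_row fun i => by rw [h i (Nat.zero_le _), map_zero]
    refine ⟨s, hs, ?_⟩
    have h0 : T.sq 0 = 0 := Subtype.ext (by simp [coe_sq])
    rw [this, h0, add_zero]
  | succ m ih =>
    intro s z hs hz h
    by_cases hm : m < r
    swap
    · exact ih hs hz fun i hi => absurd i.2 (by omega)
    set j : Fin r := ⟨m, hm⟩
    by_cases hp : T.unit j ⋆ z = 0
    · refine ih hs hz fun i hi => ?_
      rcases hi.eq_or_lt with hi | hi
      · rw [show i = j from Fin.ext hi.symm, hp]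
      · exact h i hi
    obtain ⟨c', hc', z', hz', hcj, hdiag, hrow, hsum⟩ :=
      T.exists_rotate (c := s ⋆ T.unit j) (T.mul_mem_upper hs.mem_upper (T.unit_mem_upper j))
        (by rw [mul_mul_unit, unit_mul_unit_self]) hz (fun i hi => h i hi) hp
    have h0 : (s - s ⋆ T.unit j) ⋆ T.unit j = 0 := by
      rw [map_sub, LinearMap.sub_apply, mul_mul_unit, unit_mul_unit_self, sub_self]
    have hs' : T.IsProper (s - s ⋆ T.unit j + c') := by
      refine T.isProper_iff.2 ⟨add_mem (sub_mem hs.mem_upper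
        (T.mul_mem_upper hs.mem_upper (T.unit_mem_upper j))) hc', fun i => ?_⟩
      by_cases hij : i = j
      · have : T.diag (s - s ⋆ T.unit j + c') j = T.diag c' j := by
          rw [diag_add, (T.diag_eq_zero_iff (s - s ⋆ T.unit j) j).2, zero_add]
          rw [block_eq, ← unit_mul_mul, h0, map_zero]
        rw [hij, this]
        exact ⟨hdiag.le, fun h => absurd h hdiag.ne'⟩
      · have h1 : c' ⋆ T.unit i = 0 := by
          rw [← hcj, mul_mul_unit, T.unit_mul_unit_of_ne (Ne.symm hij), map_zero]
        have h2 : (s - s ⋆ T.unit j + c') ⋆ T.unit i = s ⋆ T.unit i := by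
          rw [map_add, LinearMap.add_apply, h1, map_sub, LinearMap.sub_apply, mul_mul_unit,
            T.unit_mul_unit_of_ne (Ne.symm hij), map_zero, sub_zero, add_zero]
        have h3 : T.diag (s - s ⋆ T.unit j + c') i = T.diag s i := by
          apply T.diag_eq_of_block
          rw [block_eq, ← unit_mul_mul, h2, unit_mul_mul, ← block_eq, diag_smul_unit]
        rw [h2, h3]
        exact ⟨hs.diag_nonneg i, fun h => hs.mul_unit_eq_zero h⟩
    obtain ⟨t, ht, hts⟩ := ih hs' hz' fun i hi => hrow i hi
    refine ⟨t, ht, hts.trans ?_⟩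
    rw [T.sq_add_of_col h0 hcj, add_assoc, hsum, ← add_assoc,
      ← T.sq_add_of_col h0 (by rw [mul_mul_unit, unit_mul_unit_self]), sub_add_cancel]

theorem exists_isProper_sq_add {s z : A} (hs : T.IsProper s) (hz : z ∈ T.upper) :
    ∃ t, T.IsProper t ∧ T.sq t = T.sq s + T.sq z :=
  T.exists_isProper_add r hs hz fun i hi => absurd i.2 (by omega)

/-- Every square of a triangular element is the square of a proper one. -/
theorem exists_isProper_sq {z : A} (hz : z ∈ T.upper) : ∃ t, T.IsProper t ∧ T.sq t = T.sq z := by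
  obtain ⟨t, ht, h⟩ := T.exists_isProper_sq_add T.isProper_zero hz
  refine ⟨t, ht, h.trans ?_⟩
  have h0 : T.sq 0 = 0 := Subtype.ext (by simp [coe_sq])
  rw [h0, zero_add]

end Factorization
end TAlgebra

/-! ### Order units of convex cones -/

section OrderUnits

variable {E : Type u}

/-- `x` is an order unit of `F`: it lies in `F`, and every `y ∈ F` satisfies `ε y ≤ x` for some
`ε > 0` in the order defined by `F`. In finite dimensions this describes the relative interior of a
convex cone without reference to the topology. -/
def IsOrderUnit [AddCommGroup E] [Module ℝ E] (F : Set E) (x : E) : Prop :=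
  x ∈ F ∧ ∀ y ∈ F, ∃ ε : ℝ, 0 < ε ∧ x - ε • y ∈ F

theorem IsConvexCone.convex [AddCommGroup E] [Module ℝ E] {F : Set E} (hF : IsConvexCone F) :
    Convex ℝ F :=
  convex_iff_forall_pos.2 fun x hx y hy a b ha hb _ =>
    hF.add_mem _ (hF.smul_mem a ha x hx) _ (hF.smul_mem b hb y hy)

theorem IsOrderUnit.image [AddCommGroup E] [Module ℝ E] {E' : Type*} [AddCommGroup E']
    [Module ℝ E'] (Q : E →ₗ[ℝ] E') {F : Set E} {x : E} (h : IsOrderUnit F x) :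
    IsOrderUnit (Q '' F) (Q x) := by
  refine ⟨⟨x, h.1, rfl⟩, ?_⟩
  rintro _ ⟨y, hy, rfl⟩
  obtain ⟨ε, hε, hxy⟩ := h.2 y hy
  exact ⟨ε, hε, _, hxy, by simp⟩

variable [NormedAddCommGroup E] [NormedSpace ℝ E] [FiniteDimensional ℝ E]

/-- In finite dimensions the relative interior of a convex cone is its set of order units. -/
theorem mem_intrinsicInterior_iff_isOrderUnit {F : Set E} (hF : IsConvexCone F) {x : E} :
    x ∈ intrinsicInterior ℝ F ↔ IsOrderUnit F x := by
  constructor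
  · intro hx
    have hxF := intrinsicInterior_subset hx
    refine ⟨hxF, fun y hy => ?_⟩
    obtain ⟨x', hx', rfl⟩ := mem_intrinsicInterior.1 hx
    have hyS := subset_affineSpan ℝ F hy
    let γ : ℝ → affineSpan ℝ F := fun t =>
      ⟨AffineMap.lineMap (x' : E) y (-t), AffineMap.lineMap_mem _ x'.2 hyS⟩
    have hγ : Continuous γ := by
      refine Continuous.subtype_mk ?_ _
      simp only [AffineMap.lineMap_apply]
      fun_prop
    have hγ0 : γ 0 = x' := Subtype.ext (by simp [γ])
    have h1 : ∀ᶠ t in nhds (0 : ℝ), γ t ∈ interior ((↑) ⁻¹' F : Set (affineSpan ℝ F)) :=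
      hγ.continuousAt.eventually_mem (by rw [hγ0]; exact isOpen_interior.mem_nhds hx')
    obtain ⟨δ, hδ, h2⟩ := Metric.eventually_nhds_iff.1 h1
    have h3 : (γ (δ / 2) : E) ∈ F :=
      interior_subset (s := ((↑) ⁻¹' F : Set (affineSpan ℝ F))) (h2 (by
        rw [Real.dist_eq, sub_zero, abs_of_pos (by positivity)]; linarith))
    refine ⟨(1 + δ / 2)⁻¹ * (δ / 2), by positivity, ?_⟩
    have h4 := hF.smul_mem (1 + δ / 2)⁻¹ (by positivity) _ h3
    have h5 : (1 + δ / 2)⁻¹ • (γ (δ / 2) : E) = (x' : E) - ((1 + δ / 2)⁻¹ * (δ / 2)) • y := by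
      simp only [γ, AffineMap.lineMap_apply, vsub_eq_sub, vadd_eq_add]
      match_scalars
      · ring
      · field_simp
        ring
    rwa [h5] at h4
  · rintro ⟨hx, h⟩
    obtain ⟨z, hz⟩ := Set.Nonempty.intrinsicInterior hF.convex ⟨x, hx⟩
    obtain ⟨ε, hε, hxz⟩ := h z (intrinsicInterior_subset hz)
    obtain ⟨z', hz', rfl⟩ := mem_intrinsicInterior.1 hz
    obtain ⟨δ, hδ, hball⟩ := Metric.isOpen_iff.1 isOpen_interior z' hz'
    have hxS := subset_affineSpan ℝ F hx
    refine mem_intrinsicInterior.2 ⟨⟨x, hxS⟩, ?_, rfl⟩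
    rw [mem_interior_iff_mem_nhds, Metric.mem_nhds_iff]
    refine ⟨ε * δ, mul_pos hε hδ, fun w hw => ?_⟩
    have hmem : ε⁻¹ • ((w : E) -ᵥ x) +ᵥ (z' : E) ∈ affineSpan ℝ F :=
      AffineSubspace.vadd_mem_of_mem_direction (Submodule.smul_mem _ _
        (AffineSubspace.vsub_mem_direction w.2 hxS)) z'.2
    have h1 : ε⁻¹ • ((w : E) -ᵥ x) +ᵥ (z' : E) ∈ F := by
      refine interior_subset (s := ((↑) ⁻¹' F : Set (affineSpan ℝ F))) (hball
        (show (⟨_, hmem⟩ : affineSpan ℝ F) ∈ Metric.ball z' δ from ?_))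
      have hw' : dist (w : E) x < ε * δ := hw
      rw [Metric.mem_ball, Subtype.dist_eq]
      simp only [vsub_eq_sub, vadd_eq_add, dist_add_self_left, norm_smul, norm_inv,
        Real.norm_eq_abs, abs_of_pos hε]
      rw [inv_mul_lt_iff₀ hε, ← dist_eq_norm]
      exact hw'
    have h2 := hF.add_mem _ hxz _ (hF.smul_mem ε hε _ h1)
    have h3 : x - ε • (z' : E) + ε • (ε⁻¹ • ((w : E) -ᵥ x) +ᵥ (z' : E)) = w := by
      rw [vadd_eq_add, smul_add, smul_inv_smul₀ hε.ne', vsub_eq_sub]; abel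
    change (w : E) ∈ F
    rwa [h3] at h2

theorem IsConvexCone.exists_isOrderUnit {F : Set E} (hF : IsConvexCone F) (hne : F.Nonempty) :
    ∃ x, IsOrderUnit F x := by
  obtain ⟨z, hz⟩ := Set.Nonempty.intrinsicInterior hF.convex hne
  exact ⟨z, (mem_intrinsicInterior_iff_isOrderUnit hF).1 hz⟩

end OrderUnits

namespace TAlgebra

/-! ### Coordinate faces -/

section CoordFace

variable {r : ℕ} {A : Type u} [AddCommGroup A] [Module ℝ A] (T : TAlgebra r A)

local notation:70 a:70 " ⋆ " b:71 => T.mul a b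

/-- The face `{t t* | t upper triangular, with vanishing rows in I}` of the closed cone; it is the
closure of the cone of `A_I`. For `I = ∅` it is the closed cone itself. -/
def coordFace (I : Finset (Fin r)) : Set T.herm :=
  {x | ∃ t ∈ T.upper, (∀ i ∈ I, T.unit i ⋆ t = 0) ∧ x = T.sq t}

theorem sq_smul (c : ℝ) (t : A) : T.sq (c • t) = (c * c) • T.sq t := by
  apply Subtype.ext
  simp [coe_sq, smul_smul]

theorem sq_mem_coordFace_empty {t : A} (ht : t ∈ T.upper) : T.sq t ∈ T.coordFace ∅ :=
  ⟨t, ht, by simp, rfl⟩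

/-- The coordinate faces are cut out of the closed cone by the vanishing of diagonal entries,
because the `i`-th diagonal entry of `t t*` is the squared norm of the `i`-th row of `t`. -/
theorem mem_coordFace_iff {I : Finset (Fin r)} {x : T.herm} :
    x ∈ T.coordFace I ↔ x ∈ T.coordFace ∅ ∧ ∀ i ∈ I, T.diag x i = 0 := by
  constructor
  · rintro ⟨t, ht, h, rfl⟩
    exact ⟨T.sq_mem_coordFace_empty ht, fun i hi => (T.diag_mul_invol_eq_zero_iff t i).2 (h i hi)⟩
  · rintro ⟨⟨t, ht, -, rfl⟩, h⟩
    exact ⟨t, ht, fun i hi => (T.diag_mul_invol_eq_zero_iff t i).1 (h i hi), rfl⟩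

theorem diag_nonneg_of_mem {x : T.herm} (hx : x ∈ T.coordFace ∅) (i : Fin r) :
    0 ≤ T.diag x i := by
  obtain ⟨t, -, -, rfl⟩ := hx
  exact T.diag_mul_invol_nonneg t i

/-- The proper factor of an element of a coordinate face lies in `A_I`: its rows in `I` vanish,
hence the diagonal entries, and by properness the columns. -/
theorem exists_isProper_of_mem {I : Finset (Fin r)} {x : T.herm} (hx : x ∈ T.coordFace I) :
    ∃ t, T.IsProper t ∧ (∀ i ∈ I, T.unit i ⋆ t = 0 ∧ t ⋆ T.unit i = 0) ∧ x = T.sq t := by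
  obtain ⟨⟨s, hs, -, rfl⟩, h⟩ := T.mem_coordFace_iff.1 hx
  obtain ⟨t, ht, hts⟩ := T.exists_isProper_sq hs
  refine ⟨t, ht, fun i hi => ?_, hts.symm⟩
  have h1 : T.unit i ⋆ t = 0 := by
    rw [← diag_mul_invol_eq_zero_iff, ← coe_sq, hts]; exact h i hi
  refine ⟨h1, ht.mul_unit_eq_zero ?_⟩
  rw [diag_eq_zero_iff, block_eq, h1, LinearMap.map_zero₂]

theorem isConvexCone_coordFace (I : Finset (Fin r)) : IsConvexCone (T.coordFace I) := by
  constructor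
  · intro x hx y hy
    rw [mem_coordFace_iff] at *
    refine ⟨?_, fun i hi => by rw [Submodule.coe_add, diag_add, hx.2 i hi, hy.2 i hi, add_zero]⟩
    obtain ⟨t, ht, -, hxt⟩ := T.exists_isProper_of_mem hx.1
    obtain ⟨s, hs, -, hys⟩ := hy.1
    obtain ⟨w, hw, hws⟩ := T.exists_isProper_sq_add ht hs
    rw [hxt, hys, ← hws]
    exact T.sq_mem_coordFace_empty hw.mem_upper
  · rintro c hc _ ⟨t, ht, h, rfl⟩
    refine ⟨Real.sqrt c • t, T.upper.smul_mem _ ht, fun i hi => by rw [map_smul, h i hi, smul_zero],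
      ?_⟩
    rw [sq_smul, Real.mul_self_sqrt hc.le]

theorem zero_mem_coordFace (I : Finset (Fin r)) : (0 : T.herm) ∈ T.coordFace I :=
  ⟨0, zero_mem _, by simp, Subtype.ext (by simp [coe_sq])⟩

theorem coordFace_subset (I : Finset (Fin r)) : T.coordFace I ⊆ T.coordFace ∅ :=
  fun _ hx => (T.mem_coordFace_iff.1 hx).1

theorem isConeFace_coordFace (I : Finset (Fin r)) :
    IsConeFace (T.coordFace I) (T.coordFace ∅) where
  subset := T.coordFace_subset I
  nonempty := ⟨0, T.zero_mem_coordFace I⟩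
  isConvexCone := T.isConvexCone_coordFace I
  mem_of_add_mem := by
    intro x hx y hy hxy
    have h := (T.mem_coordFace_iff.1 hxy).2
    have key : ∀ i ∈ I, T.diag x i = 0 ∧ T.diag y i = 0 := fun i hi => by
      have h1 := h i hi
      rw [Submodule.coe_add, diag_add] at h1
      exact (add_eq_zero_iff_of_nonneg (T.diag_nonneg_of_mem hx i)
        (T.diag_nonneg_of_mem hy i)).1 h1
    exact ⟨T.mem_coordFace_iff.2 ⟨hx, fun i hi => (key i hi).1⟩,
      T.mem_coordFace_iff.2 ⟨hy, fun i hi => (key i hi).2⟩⟩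

theorem quad_mem_closed {u : A} (hu : u ∈ T.upper) {x : T.herm} (hx : x ∈ T.coordFace ∅) :
    T.quad u x ∈ T.coordFace ∅ := by
  obtain ⟨t, ht, -, rfl⟩ := hx
  rw [T.quad_sq hu ht]
  exact T.sq_mem_coordFace_empty (T.mul_mem_upper hu ht)

theorem idem_add_idem_compl (I : Finset (Fin r)) :
    T.idem I + T.idem Iᶜ = T.idem Finset.univ := Finset.sum_add_sum_compl I _

theorem sq_idem_mem_coordFace (I : Finset (Fin r)) : T.sq (T.idem Iᶜ) ∈ T.coordFace I :=
  ⟨_, T.idem_mem_upper _, fun i hi => by simp [unit_mul_idem, hi], rfl⟩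

theorem coe_sq_idem (J : Finset (Fin r)) : (T.sq (T.idem J) : A) = T.idem J := by
  rw [coe_sq, invol_idem]
  refine T.idem_mul_eq_self fun i hi => ?_
  rw [unit_mul_idem, if_neg hi]

theorem quad_idem_mem_coordFace (I : Finset (Fin r)) {x : T.herm} (hx : x ∈ T.coordFace ∅) :
    T.quad (T.idem Iᶜ) x ∈ T.coordFace I := by
  obtain ⟨t, ht, -, rfl⟩ := hx
  rw [T.quad_sq (T.idem_mem_upper _) ht]
  exact ⟨_, T.mul_mem_upper (T.idem_mem_upper _) ht, fun i hi => by
    simp [unit_mul_idem_mul, hi], rfl⟩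

theorem quad_idem_of_mem {I : Finset (Fin r)} {x : T.herm} (hx : x ∈ T.coordFace I) :
    T.quad (T.idem Iᶜ) x = x := by
  obtain ⟨t, ht, h, rfl⟩ := hx
  rw [T.quad_sq (T.idem_mem_upper _) ht, T.idem_mul_eq_self fun i hi => h i (by simpa using hi)]

/-! ### The group of triangular elements fixing a coordinate face -/

/-- The elements of the triangular group of the form `v' + ∑_{i ∈ I} eᵢ` with `v' ∈ A_I`. -/
def stab (I : Finset (Fin r)) : Set A :=
  {v | v ∈ T.UTpp ∧ ∀ i ∈ I, T.unit i ⋆ v = T.unit i ∧ v ⋆ T.unit i = T.unit i}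

theorem one_mem_stab (I : Finset (Fin r)) : T.idem Finset.univ ∈ T.stab I :=
  ⟨T.one_mem_UTpp, fun _ _ => ⟨T.mul_idem_univ _, T.idem_univ_mul _⟩⟩

theorem mul_mem_stab {I : Finset (Fin r)} {v w : A} (hv : v ∈ T.stab I) (hw : w ∈ T.stab I) :
    v ⋆ w ∈ T.stab I :=
  ⟨T.mul_mem_UTpp hv.1 hw.1, fun i hi => ⟨by rw [unit_mul_mul, (hv.2 i hi).1, (hw.2 i hi).1],
    by rw [mul_mul_unit, (hw.2 i hi).2, (hv.2 i hi).2]⟩⟩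

theorem inv_mem_stab {I : Finset (Fin r)} {v w : A} (hv : v ∈ T.stab I) (hw : w ∈ T.UTpp)
    (h : w ⋆ v = T.idem Finset.univ) (h' : v ⋆ w = T.idem Finset.univ) : w ∈ T.stab I := by
  refine ⟨hw, fun i hi => ⟨?_, ?_⟩⟩
  · conv_lhs => rw [← (hv.2 i hi).1]
    rw [← unit_mul_mul, h', mul_idem_univ]
  · conv_lhs => rw [← (hv.2 i hi).2]
    rw [← mul_mul_unit, h, idem_univ_mul]

theorem quad_mem_coordFace {I : Finset (Fin r)} {v : A} (hv : v ∈ T.stab I) {x : T.herm}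
    (hx : x ∈ T.coordFace I) : T.quad v x ∈ T.coordFace I := by
  obtain ⟨t, ht, h, rfl⟩ := hx
  rw [T.quad_sq hv.1.1 ht]
  exact ⟨_, T.mul_mem_upper hv.1.1 ht, fun i hi => by
    rw [unit_mul_mul, (hv.2 i hi).1, h i hi], rfl⟩

/-- The triangular elements of `A_I` whose diagonal is positive outside `I`. -/
def innerFactors (I : Finset (Fin r)) : Set A :=
  {s | s ∈ T.upper ∧ (∀ i ∈ I, T.unit i ⋆ s = 0 ∧ s ⋆ T.unit i = 0) ∧ ∀ i ∉ I, 0 < T.diag s i}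

theorem mem_principalSubalgebra_iff {I : Finset (Fin r)} {a : A} :
    a ∈ T.principalSubalgebra I ↔ ∀ i ∈ I, T.unit i ⋆ a = 0 ∧ a ⋆ T.unit i = 0 := by
  refine forall₂_congr fun i _ => ?_
  simp only [comp_eq_zero_iff, forall_and]
  refine and_congr ⟨fun h => T.ext_col fun k => ?_, fun h k => ?_⟩
    ⟨fun h => T.ext_row fun k => ?_, fun h k => ?_⟩
  · rw [← block_eq, h, LinearMap.map_zero₂]
  · rw [block_eq, h, LinearMap.map_zero₂]
  · rw [unit_mul_mul, ← block_eq, h, map_zero]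
  · rw [block_eq, ← unit_mul_mul, h, map_zero]

theorem mem_principalCone_iff {I : Finset (Fin r)} {x : T.herm} :
    x ∈ T.principalCone I ↔ ∃ s ∈ T.innerFactors I, x = T.sq s := by
  constructor
  · rintro ⟨t, h1, h2, h3, h4⟩
    exact ⟨t, ⟨h2, T.mem_principalSubalgebra_iff.1 h1, h3⟩, Subtype.ext h4⟩
  · rintro ⟨t, ⟨h2, h1, h3⟩, h4⟩
    exact ⟨t, T.mem_principalSubalgebra_iff.2 h1, h2, h3, congrArg Subtype.val h4⟩

theorem principalCone_empty : T.principalCone ∅ = T.cone := by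
  ext x
  rw [mem_principalCone_iff, mem_cone_iff]
  simp [innerFactors, mem_UTpp_iff]

theorem idem_compl_mem_innerFactors (I : Finset (Fin r)) : T.idem Iᶜ ∈ T.innerFactors I :=
  ⟨T.idem_mem_upper _, fun i hi => by simp [unit_mul_idem, idem_mul_unit, hi],
    fun i hi => by simp [diag_idem, hi]⟩

theorem isProper_of_mem_innerFactors {I : Finset (Fin r)} {s : A} (hs : s ∈ T.innerFactors I) :
    T.IsProper s := by
  refine T.isProper_iff.2 ⟨hs.1, fun i => ?_⟩
  by_cases hi : i ∈ I
  · have h := (hs.2.1 i hi).2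
    refine ⟨le_of_eq ((T.diag_eq_zero_iff s i).2 ?_).symm, fun _ => h⟩
    rw [block_eq, ← unit_mul_mul, h, map_zero]
  · exact ⟨(hs.2.2 i hi).le, fun h => absurd h (hs.2.2 i hi).ne'⟩

theorem diag_eq_zero_iff_of_mem_innerFactors {I : Finset (Fin r)} {s : A}
    (hs : s ∈ T.innerFactors I) (i : Fin r) : T.diag s i = 0 ↔ i ∈ I := by
  constructor
  · intro h; by_contra hi; exact (hs.2.2 i hi).ne' h
  · intro hi
    rw [diag_eq_zero_iff, block_eq, (hs.2.1 i hi).1, LinearMap.map_zero₂]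

theorem innerFactors_add_idem {I : Finset (Fin r)} {s : A} (hs : s ∈ T.innerFactors I) :
    s + T.idem I ∈ T.stab I := by
  refine ⟨⟨add_mem hs.1 (T.idem_mem_upper I), fun i => ?_⟩, fun i hi => ⟨?_, ?_⟩⟩
  · rw [diag_add, diag_idem]
    by_cases hi : i ∈ I
    · rw [(T.diag_eq_zero_iff_of_mem_innerFactors hs i).2 hi, if_pos hi]; norm_num
    · rw [if_neg hi, add_zero]; exact hs.2.2 i hi
  · rw [map_add, (hs.2.1 i hi).1, unit_mul_idem, if_pos hi, zero_add]
  · rw [LinearMap.map_add₂, (hs.2.1 i hi).2, idem_mul_unit, if_pos hi, zero_add]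

theorem add_idem_mul_idem_compl {I : Finset (Fin r)} {s : A}
    (hs : ∀ i ∈ I, s ⋆ T.unit i = 0) : (s + T.idem I) ⋆ T.idem Iᶜ = s := by
  refine T.ext_col fun i => ?_
  rw [mul_idem_mul_unit, LinearMap.map_add₂, idem_mul_unit]
  by_cases hi : i ∈ I
  · simp [hi, hs i hi]
  · simp [hi]

theorem add_idem_mul_idem {I : Finset (Fin r)} {s : A}
    (hs : ∀ i ∈ I, s ⋆ T.unit i = 0) : (s + T.idem I) ⋆ T.idem I = T.idem I := by
  refine T.ext_col fun i => ?_
  rw [mul_idem_mul_unit, LinearMap.map_add₂, idem_mul_unit]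
  by_cases hi : i ∈ I
  · simp [hi, hs i hi]
  · simp [hi]

theorem mul_mem_innerFactors {I : Finset (Fin r)} {v s : A} (hv : v ∈ T.stab I)
    (hs : s ∈ T.innerFactors I) : v ⋆ s ∈ T.innerFactors I :=
  ⟨T.mul_mem_upper hv.1.1 hs.1, fun i hi => ⟨by rw [unit_mul_mul, (hv.2 i hi).1, (hs.2.1 i hi).1],
    by rw [mul_mul_unit, (hs.2.1 i hi).2, map_zero]⟩, fun i hi => by
    rw [T.diag_mul hv.1.1 hs.1]; exact mul_pos (hv.1.2 i) (hs.2.2 i hi)⟩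

/-- The stabilizer of the coordinate face acts freely on the triangular factors of maximal rank. -/
theorem mul_right_cancel_stab {I : Finset (Fin r)} {v w s : A} (hv : v ∈ T.stab I)
    (hw : w ∈ T.stab I) (hs : s ∈ T.innerFactors I) (h : v ⋆ s = w ⋆ s) : v = w := by
  have hI : ∀ {v : A}, v ∈ T.stab I → v ⋆ T.idem I = T.idem I := fun {v} hv => by
    refine T.ext_col fun i => ?_
    rw [mul_idem_mul_unit, idem_mul_unit]
    split_ifs with hi
    · exact (hv.2 i hi).2
    · rfl
  refine sub_eq_zero.1 (T.mul_right_cancel_zero (t := s + T.idem I) (sub_mem hv.1.1 hw.1.1)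
    (T.innerFactors_add_idem hs).1 ?_)
  rw [LinearMap.map_sub₂, map_add, map_add, h, hI hv, hI hw, sub_self]

variable [FiniteDimensional ℝ A]

/-- The stabilizer of the coordinate face acts transitively on the triangular factors of maximal
rank: `v = (s' + e)(s + e)⁻¹` with `e = ∑_{i ∈ I} eᵢ`. -/
theorem exists_mem_stab_mul_eq {I : Finset (Fin r)} {s s' : A} (hs : s ∈ T.innerFactors I)
    (hs' : s' ∈ T.innerFactors I) : ∃ v ∈ T.stab I, v ⋆ s = s' := by
  have h1 := T.innerFactors_add_idem hs
  have h2 := T.innerFactors_add_idem hs'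
  obtain ⟨w, hw, hws, hsw⟩ := T.exists_inv h1.1
  refine ⟨(s' + T.idem I) ⋆ w, T.mul_mem_stab h2 (T.inv_mem_stab h1 hw hws hsw), ?_⟩
  conv_lhs => rw [← T.add_idem_mul_idem_compl fun i hi => (hs.2.1 i hi).2]
  rw [← mul_mul_idem, T.upper_assoc h2.1.1 hw.1 h1.1.1, hws, mul_idem_univ,
    T.add_idem_mul_idem_compl fun i hi => (hs'.2.1 i hi).2]

/-- The order units of a coordinate face are the elements with a factor of maximal rank. If the
proper factor `s` of `x` has a further zero on the diagonal, there is `u ≠ 0` such that the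
functional `tr Q_u`, which is nonnegative on the cone, vanishes at `x` but not on the whole face. -/
theorem exists_innerFactors_of_isOrderUnit {I : Finset (Fin r)} {x : T.herm}
    (hx : IsOrderUnit (T.coordFace I) x) : ∃ s ∈ T.innerFactors I, x = T.sq s := by
  obtain ⟨s, hs, hsI, rfl⟩ := T.exists_isProper_of_mem hx.1
  refine ⟨s, ⟨hs.mem_upper, hsI, fun j hj => ?_⟩, rfl⟩
  refine lt_of_le_of_ne (hs.diag_nonneg j) fun h0 => ?_
  have hw := add_mem hs.mem_upper (T.idem_mem_upper I)
  obtain ⟨u, hu, hu0, huw⟩ := T.exists_left_annihilator hw (i := j)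
    (by rw [diag_add, ← h0, diag_idem, if_neg hj, add_zero])
  have hsI' : ∀ i ∈ I, s ⋆ T.unit i = 0 := fun i hi => (hsI i hi).2
  have hus : u ⋆ s = 0 := by
    rw [← T.add_idem_mul_idem_compl hsI', ← mul_mul_idem, huw, LinearMap.map_zero₂]
  have huI : u ⋆ T.idem I = 0 := by
    rw [← T.add_idem_mul_idem hsI', ← mul_mul_idem, huw, LinearMap.map_zero₂]
  obtain ⟨ε, hε, t, ht, -, htx⟩ := hx.2 _ (T.sq_idem_mem_coordFace I)
  have hz : T.sq (0 : A) = 0 := Subtype.ext (by simp [coe_sq])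
  have h1 := congrArg (T.quad u) htx
  rw [map_sub, map_smul, T.quad_sq hu hs.mem_upper, T.quad_sq hu ht,
    T.quad_sq hu (T.idem_mem_upper _), hus, hz, zero_sub] at h1
  have h2 : (T.sq (u ⋆ t) : A) = -(ε • (T.sq (u ⋆ T.idem Iᶜ) : A)) := by
    rw [← h1]; simp
  have h3 := T.trace_mul_invol_nonneg (u ⋆ t)
  have h4 := T.trace_mul_invol_nonneg (u ⋆ T.idem Iᶜ)
  have htr : ∀ (c : ℝ) (a : A), T.trace (c • a) = c * T.trace a := fun c a => by
    simp only [InvolutiveBigradedAlgebra.trace, diag_smul, Finset.mul_sum]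
  rw [← coe_sq, h2, ← neg_smul, htr, coe_sq] at h3
  have h5 : u ⋆ T.idem Iᶜ = 0 := (T.trace_mul_invol_eq_zero _).1 (by nlinarith)
  apply hu0
  rw [← T.mul_idem_univ u, ← T.idem_add_idem_compl I, map_add, huI, h5, add_zero]

end CoordFace

section Normed

variable {r : ℕ} {A : Type u} [NormedAddCommGroup A] [NormedSpace ℝ A] [FiniteDimensional ℝ A]
  (T : TAlgebra r A)

local notation:70 a:70 " ⋆ " b:71 => T.mul a b

/-- The relative interior of a coordinate face is the cone of `A_I`. Some order unit exists for
general reasons, it lies in the cone of `A_I`, and the stabilizer of the face is transitive there.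
-/
theorem isOrderUnit_coordFace_iff {I : Finset (Fin r)} {x : T.herm} :
    IsOrderUnit (T.coordFace I) x ↔ x ∈ T.principalCone I := by
  rw [mem_principalCone_iff]
  refine ⟨T.exists_innerFactors_of_isOrderUnit, ?_⟩
  rintro ⟨s, hs, rfl⟩
  obtain ⟨z, hz⟩ := (T.isConvexCone_coordFace I).exists_isOrderUnit ⟨0, T.zero_mem_coordFace I⟩
  obtain ⟨s₀, hs₀, rfl⟩ := T.exists_innerFactors_of_isOrderUnit hz
  obtain ⟨v, hv, rfl⟩ := T.exists_mem_stab_mul_eq hs₀ hs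
  obtain ⟨w, hw, hwv, hvw⟩ := T.exists_inv hv.1
  have hwS := T.inv_mem_stab hv hw hwv hvw
  rw [← T.quad_sq hv.1.1 hs₀.1]
  refine ⟨T.quad_mem_coordFace hv hz.1, fun y hy => ?_⟩
  obtain ⟨ε, hε, h⟩ := hz.2 _ (T.quad_mem_coordFace hwS hy)
  refine ⟨ε, hε, ?_⟩
  have := T.quad_mem_coordFace hv h
  rwa [map_sub, map_smul, T.quad_quad hv.1.1 hw.1, hvw, quad_one] at this

/-! ### Closures -/

theorem continuous_mul_invol : Continuous fun t : A => t ⋆ T.invol t := by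
  have h1 : Continuous T.invol := T.invol.continuous_of_finiteDimensional
  let m : A →ₗ[ℝ] A →L[ℝ] A := LinearMap.toContinuousLinearMap.toLinearMap ∘ₗ T.mul
  have h2 : Continuous m := m.continuous_of_finiteDimensional
  exact h2.clm_apply h1

theorem continuous_sq : Continuous T.sq := T.continuous_mul_invol.subtype_mk _

theorem continuous_diag (i : Fin r) : Continuous fun a => T.diag a i :=
  ((T.rho i).toLinearMap ∘ₗ T.comp i i).continuous_of_finiteDimensional

theorem continuous_trace : Continuous T.trace :=
  continuous_finsetSum _ fun i _ => T.continuous_diag i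

/-- The quadratic form `tr(t t*)` is coercive. -/
theorem exists_norm_sq_le : ∃ c : ℝ, 0 < c ∧ ∀ t : A, c * ‖t‖ ^ 2 ≤ T.trace (t ⋆ T.invol t) := by
  rcases subsingleton_or_nontrivial A with h | h
  · refine ⟨1, one_pos, fun t => ?_⟩
    rw [Subsingleton.elim t 0]; simp [InvolutiveBigradedAlgebra.trace, diag_zero]
  have hcont : Continuous fun t : A => T.trace (t ⋆ T.invol t) :=
    T.continuous_trace.comp T.continuous_mul_invol
  obtain ⟨t₀, ht₀, hmin⟩ := (isCompact_sphere (0 : A) 1).exists_isMinOn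
    ((NormedSpace.sphere_nonempty (E := A)).2 zero_le_one) hcont.continuousOn
  have ht₀1 : ‖t₀‖ = 1 := by simpa using ht₀
  have hne : t₀ ≠ 0 := fun h => by simp [h] at ht₀1
  refine ⟨_, lt_of_le_of_ne (T.trace_mul_invol_nonneg t₀) fun h =>
    hne ((T.trace_mul_invol_eq_zero t₀).1 h.symm), fun t => ?_⟩
  have htr : ∀ (c : ℝ) (a : A), T.trace (c • a) = c * T.trace a := fun c a => by
    simp only [InvolutiveBigradedAlgebra.trace, diag_smul, Finset.mul_sum]
  by_cases ht : t = 0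
  · subst ht; simp [InvolutiveBigradedAlgebra.trace, diag_zero]
  have hn : 0 < ‖t‖ := norm_pos_iff.2 ht
  have h1 := hmin (show ‖t‖⁻¹ • t ∈ Metric.sphere (0 : A) 1 by
    simp [norm_smul, hn.ne'])
  simp only [Set.mem_ofPred_eq, map_smul, LinearMap.smul_apply, htr] at h1
  have h2 : T.trace (t ⋆ T.invol t) =
      (‖t‖⁻¹ * (‖t‖⁻¹ * T.trace (t ⋆ T.invol t))) * ‖t‖ ^ 2 := by field_simp
  rw [h2]
  exact mul_le_mul_of_nonneg_right h1 (by positivity)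

theorem isClosed_upper : IsClosed (T.upper : Set A) := T.upper.closed_of_finiteDimensional

/-- By coercivity of `tr(t t*)`, the factors of a convergent sequence are bounded. -/
theorem isClosed_coordFace_empty : IsClosed (T.coordFace ∅) := by
  refine isSeqClosed_iff_isClosed.1 fun x y hx hxy => ?_
  choose t ht _ hxt using hx
  obtain ⟨c, hc, hcoer⟩ := T.exists_norm_sq_le
  have h1 : Filter.Tendsto (fun n => T.trace (x n : A)) Filter.atTop (nhds (T.trace (y : A))) :=
    ((T.continuous_trace.comp continuous_subtype_val).tendsto y).comp hxy
  obtain ⟨M, hM⟩ := h1.bddAbove_range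
  have hbdd : ∀ n, t n ∈ Metric.closedBall (0 : A) (Real.sqrt (M / c)) := fun n => by
    rw [mem_closedBall_zero_iff]
    refine Real.le_sqrt_of_sq_le ?_
    rw [le_div_iff₀ hc, mul_comm]
    refine (hcoer (t n)).trans ?_
    rw [← coe_sq, ← hxt n]
    exact hM ⟨n, rfl⟩
  obtain ⟨t₀, -, φ, hφ, hlim⟩ := (isCompact_closedBall (0 : A) _).tendsto_subseq hbdd
  have ht₀ : t₀ ∈ T.upper := T.isClosed_upper.mem_of_tendsto hlim (.of_forall fun n => ht _)
  have h2 : Filter.Tendsto (fun n => x (φ n)) Filter.atTop (nhds (T.sq t₀)) := by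
    simp only [hxt]
    exact (T.continuous_sq.tendsto t₀).comp hlim
  rw [tendsto_nhds_unique (hxy.comp hφ.tendsto_atTop) h2]
  exact T.sq_mem_coordFace_empty ht₀

theorem isClosed_coordFace (I : Finset (Fin r)) : IsClosed (T.coordFace I) := by
  have : T.coordFace I = T.coordFace ∅ ∩ ⋂ i ∈ I, {x : T.herm | T.diag (x : A) i = 0} := by
    ext x
    simp only [Set.mem_inter_iff, Set.mem_iInter, Set.mem_ofPred_eq]
    exact T.mem_coordFace_iff
  rw [this]
  refine T.isClosed_coordFace_empty.inter (isClosed_biInter fun i _ => ?_)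
  exact isClosed_eq ((T.continuous_diag i).comp continuous_subtype_val) continuous_const

theorem closure_principalCone (I : Finset (Fin r)) :
    closure (T.principalCone I) = T.coordFace I := by
  apply Set.Subset.antisymm
  · refine closure_minimal (fun x hx => ?_) (T.isClosed_coordFace I)
    obtain ⟨s, hs, rfl⟩ := T.mem_principalCone_iff.1 hx
    exact ⟨s, hs.1, fun i hi => (hs.2.1 i hi).1, rfl⟩
  · intro x hx
    obtain ⟨t, ht, htI, rfl⟩ := T.exists_isProper_of_mem hx
    have hlim : Filter.Tendsto (fun ε : ℝ => T.sq (t + ε • T.idem Iᶜ)) (nhdsWithin 0 (Set.Ioi 0))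
        (nhds (T.sq t)) := by
      have hc : Continuous fun ε : ℝ => T.sq (t + ε • T.idem Iᶜ) := T.continuous_sq.comp
        (by fun_prop)
      have := hc.tendsto 0
      rw [zero_smul, add_zero] at this
      exact this.mono_left nhdsWithin_le_nhds
    refine mem_closure_of_tendsto hlim ?_
    filter_upwards [self_mem_nhdsWithin] with ε hε
    refine T.mem_principalCone_iff.2 ⟨_, ⟨add_mem ht.mem_upper (T.upper.smul_mem _
      (T.idem_mem_upper _)), fun i hi => ⟨?_, ?_⟩, fun i hi => ?_⟩, rfl⟩
    · simp [(htI i hi).1, unit_mul_idem, hi]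
    · simp [(htI i hi).2, idem_mul_unit, hi]
    · rw [diag_add, diag_smul, diag_idem, if_pos (by simpa using hi), mul_one]
      exact add_pos_of_nonneg_of_pos (ht.diag_nonneg i) hε

theorem closure_cone : closure T.cone = T.coordFace ∅ := by
  rw [← principalCone_empty, closure_principalCone]

theorem isOrderUnit_closed_iff {x : T.herm} : IsOrderUnit (T.coordFace ∅) x ↔ x ∈ T.cone := by
  rw [isOrderUnit_coordFace_iff, principalCone_empty]

end Normed
end TAlgebra

/-! ### Chains of faces and the rank -/

/-- The elements `x` with `x + K ⊆ K`. For the cone of a T-algebra this is the closure, described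
without reference to a topology. -/
def absorbing {E : Type*} [AddCommGroup E] (K : Set E) : Set E := {x | ∀ y ∈ K, x + y ∈ K}

/-- There is a strict chain of length `k`, in the preorder `∃ ε > 0, ε x ≤ y` on the absorbing
elements of `K`. Such a chain amounts to a chain of `k + 1` faces of the closed cone. -/
def HasChain {E : Type*} [AddCommGroup E] [Module ℝ E] (K : Set E) (k : ℕ) : Prop :=
  ∃ x : Fin (k + 1) → E, (∀ i, x i ∈ absorbing K) ∧ ∀ i j, i < j →
    (∃ ε : ℝ, 0 < ε ∧ x j - ε • x i ∈ absorbing K) ∧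
    ¬ ∃ ε : ℝ, 0 < ε ∧ x i - ε • x j ∈ absorbing K

theorem HasChain.of_equiv {E E' : Type*} [AddCommGroup E] [Module ℝ E] [AddCommGroup E']
    [Module ℝ E'] (φ : E ≃ₗ[ℝ] E') {K : Set E} {K' : Set E'} (h : φ '' K = K') {k : ℕ}
    (hK : HasChain K k) : HasChain K' k := by
  have key : ∀ x, φ x ∈ absorbing K' ↔ x ∈ absorbing K := fun x => by
    subst h
    constructor
    · intro hx y hy
      obtain ⟨z, hz, hzx⟩ := hx _ ⟨y, hy, rfl⟩
      rw [← map_add] at hzx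
      rwa [← φ.injective hzx]
    · rintro hx _ ⟨y, hy, rfl⟩
      exact ⟨_, hx y hy, map_add φ x y⟩
  obtain ⟨x, hx, hij⟩ := hK
  refine ⟨fun i => φ (x i), fun i => (key _).2 (hx i), fun i j h => ?_⟩
  simp only [← map_smul, ← map_sub, key]
  exact hij i j h

namespace TAlgebra

section Algebraic

variable {r : ℕ} {A : Type u} [AddCommGroup A] [Module ℝ A] [FiniteDimensional ℝ A]
  (T : TAlgebra r A)

local notation:70 a:70 " ⋆ " b:71 => T.mul a b

/-- A proper element becomes the idempotent of its nonzero diagonal positions after multiplication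
by a suitable element of the triangular group. -/
theorem exists_mul_eq_idem {t : A} (ht : T.IsProper t) {I : Finset (Fin r)}
    (hI : ∀ i, i ∈ I ↔ T.diag t i = 0) :
    ∃ u ∈ T.UTpp, u ⋆ t = T.idem Iᶜ := by
  have h1 : t + T.idem I ∈ T.UTpp := by
    refine ⟨add_mem ht.mem_upper (T.idem_mem_upper I), fun i => ?_⟩
    rw [diag_add, diag_idem]
    by_cases hi : i ∈ I
    · rw [if_pos hi, (hI i).1 hi]; norm_num
    · rw [if_neg hi, add_zero]
      exact lt_of_le_of_ne (ht.diag_nonneg i) fun h => hi ((hI i).2 h.symm)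
  obtain ⟨u, hu, hut, -⟩ := T.exists_inv h1
  refine ⟨u, hu, ?_⟩
  conv_lhs => rw [← T.add_idem_mul_idem_compl (I := I) (s := t)
    fun i hi => ht.mul_unit_eq_zero ((hI i).1 hi)]
  rw [← mul_mul_idem, hut, idem_univ_mul]

theorem quad_mem_iff {u : A} (hu : u ∈ T.UTpp) {x : T.herm} :
    T.quad u x ∈ T.coordFace ∅ ↔ x ∈ T.coordFace ∅ := by
  refine ⟨fun h => ?_, T.quad_mem_closed hu.1⟩
  obtain ⟨w, hw, hwu, -⟩ := T.exists_inv hu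
  have := T.quad_mem_closed hw.1 h
  rwa [T.quad_quad hw.1 hu.1, hwu, quad_one] at this

end Algebraic

section Normed

variable {r : ℕ} {A : Type u} [NormedAddCommGroup A] [NormedSpace ℝ A] [FiniteDimensional ℝ A]
  (T : TAlgebra r A)

local notation:70 a:70 " ⋆ " b:71 => T.mul a b

theorem absorbing_cone : absorbing T.cone = T.coordFace ∅ := by
  apply Set.Subset.antisymm
  · intro x hx
    have hlim : Filter.Tendsto (fun ε : ℝ => x + (ε * ε) • T.sq (T.idem Finset.univ))
        (nhdsWithin 0 (Set.Ioi 0)) (nhds x) := by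
      have hc : Continuous fun ε : ℝ => x + (ε * ε) • T.sq (T.idem Finset.univ) := by fun_prop
      have := hc.tendsto 0
      rw [zero_mul, zero_smul, add_zero] at this
      exact this.mono_left nhdsWithin_le_nhds
    rw [← closure_cone]
    refine mem_closure_of_tendsto hlim ?_
    filter_upwards [self_mem_nhdsWithin] with ε hε
    refine hx _ (T.mem_cone_iff.2 ⟨ε • T.idem Finset.univ, ⟨T.upper.smul_mem _
      (T.idem_mem_upper _), fun i => ?_⟩, (T.sq_smul _ _).symm⟩)
    rw [diag_smul, diag_idem, if_pos (Finset.mem_univ _), mul_one]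
    exact hε
  · intro x hx y hy
    rw [← isOrderUnit_closed_iff] at hy ⊢
    have hC := T.isConvexCone_coordFace ∅
    refine ⟨hC.add_mem _ hx _ hy.1, fun z hz => ?_⟩
    obtain ⟨ε, hε, h⟩ := hy.2 z hz
    refine ⟨ε, hε, ?_⟩
    rw [add_sub_assoc]
    exact hC.add_mem _ hx _ h

/-- If `s s* ≤ t t*` up to a positive factor, the proper element `s` has its nonzero diagonal
positions among those of `t`; if all are attained, the two elements generate the same face. -/
theorem diag_eq_zero_of_dominated {s t : A} (hs : T.IsProper s) (ht : T.IsProper t) {ε : ℝ}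
    (hε : 0 < ε) (h : T.sq t - ε • T.sq s ∈ T.coordFace ∅) :
    (∀ i, T.diag t i = 0 → T.diag s i = 0) ∧ ((∀ i, T.diag s i = 0 → T.diag t i = 0) →
      ∃ δ : ℝ, 0 < δ ∧ T.sq s - δ • T.sq t ∈ T.coordFace ∅) := by
  classical
  set I := Finset.univ.filter fun i => T.diag t i = 0
  have hI : ∀ i, i ∈ I ↔ T.diag t i = 0 := fun i => by simp [I]
  obtain ⟨u, hu, hut⟩ := T.exists_mul_eq_idem ht hI
  have h1 := (T.quad_mem_iff hu).2 h
  rw [map_sub, map_smul, T.quad_sq hu.1 ht.mem_upper, T.quad_sq hu.1 hs.mem_upper, hut] at h1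
  have hus := T.isProper_mul hu hs
  have h2 : T.sq (u ⋆ s) ∈ T.coordFace I := by
    rw [mem_coordFace_iff]
    refine ⟨T.sq_mem_coordFace_empty hus.mem_upper, fun i hi => ?_⟩
    have h3 := T.diag_nonneg_of_mem h1 i
    have h4 := T.diag_mul_invol_nonneg (u ⋆ s) i
    rw [AddSubgroupClass.coe_sub, Submodule.coe_smul, coe_sq_idem, sub_eq_add_neg, ← neg_smul,
      diag_add, diag_smul, diag_idem, if_neg (by simpa using hi), zero_add] at h3
    rw [coe_sq] at h3 ⊢
    nlinarith
  obtain ⟨s', hs', hs'I, hss'⟩ := T.exists_isProper_of_mem h2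
  have h5 := T.proper_unique hus hs' hss'
  rw [← h5] at hs'I
  have h6 : ∀ i, T.diag t i = 0 → T.diag s i = 0 := fun i hi => by
    have h7 : T.diag (u ⋆ s) i = 0 := by
      rw [diag_eq_zero_iff, block_eq, (hs'I i ((hI i).2 hi)).1, LinearMap.map_zero₂]
    rw [T.diag_mul hu.1 hs.mem_upper] at h7
    exact (mul_eq_zero.1 h7).resolve_left (hu.2 i).ne'
  refine ⟨h6, fun h7 => ?_⟩
  have h8 : u ⋆ s ∈ T.innerFactors I := by
    refine ⟨hus.mem_upper, hs'I, fun i hi => lt_of_le_of_ne (hus.diag_nonneg i) fun h0 => ?_⟩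
    rw [T.diag_mul hu.1 hs.mem_upper] at h0
    exact hi ((hI i).2 (h7 i ((mul_eq_zero.1 h0.symm).resolve_left (hu.2 i).ne')))
  obtain ⟨δ, hδ, h9⟩ := (T.isOrderUnit_coordFace_iff.2
    (T.mem_principalCone_iff.2 ⟨_, h8, rfl⟩)).2 _ (T.sq_idem_mem_coordFace I)
  refine ⟨δ, hδ, (T.quad_mem_iff hu).1 ?_⟩
  rw [map_sub, map_smul, T.quad_sq hu.1 ht.mem_upper, T.quad_sq hu.1 hs.mem_upper, hut]
  exact T.coordFace_subset I h9

/-- Along a strict chain the set of nonzero diagonal positions of the proper factor grows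
strictly. -/
theorem le_of_hasChain {k : ℕ} (h : HasChain T.cone k) : k ≤ r := by
  classical
  obtain ⟨x, hx, hij⟩ := h
  simp only [absorbing_cone] at hx hij
  choose t ht _ hxt using fun i => T.exists_isProper_of_mem (hx i)
  let S : Fin (k + 1) → Finset (Fin r) := fun i => Finset.univ.filter fun l => T.diag (t i) l ≠ 0
  have hS : ∀ i j, i < j → S i ⊂ S j := by
    intro i j hlt
    obtain ⟨⟨ε, hε, h1⟩, h2⟩ := hij i j hlt
    rw [hxt i, hxt j] at h1 h2
    obtain ⟨h3, h4⟩ := T.diag_eq_zero_of_dominated (ht i) (ht j) hε h1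
    refine Finset.ssubset_iff_subset_ne.2 ⟨fun l hl => ?_, fun heq => h2 (h4 fun l hl => ?_)⟩
    · simp only [S, Finset.mem_filter, Finset.mem_univ, true_and] at hl ⊢
      exact fun h => hl (h3 l h)
    · by_contra hne
      have : l ∈ S i := by rw [heq]; simpa [S] using hne
      simp [S, hl] at this
  let f : Fin (k + 1) → Fin (r + 1) := fun i => ⟨(S i).card,
    Nat.lt_succ_of_le ((Finset.card_le_univ _).trans_eq (Fintype.card_fin r))⟩
  have hf : StrictMono f := fun i j h => Finset.card_lt_card (hS i j h)
  have := Fintype.card_le_of_injective f hf.injective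
  simpa using this

/-- The idempotents `e₁ + ⋯ + eᵢ`, `0 ≤ i ≤ r`, form a strict chain of length `r`. -/
theorem hasChain_cone : HasChain T.cone r := by
  classical
  let J : Fin (r + 1) → Finset (Fin r) := fun i => Finset.univ.filter fun l => l.val < i.val
  refine ⟨fun i => T.sq (T.idem (J i)), fun i => ?_, fun i j hlt => ⟨⟨1, one_pos, ?_⟩, ?_⟩⟩
  · rw [absorbing_cone]; exact T.sq_mem_coordFace_empty (T.idem_mem_upper _)
  · have hsub : J i ⊆ J j := fun l hl => by
      simp only [J, Finset.mem_filter, Finset.mem_univ, true_and] at hl ⊢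
      exact hl.trans hlt
    have h1 : T.sq (T.idem (J j)) - (1 : ℝ) • T.sq (T.idem (J i)) =
        T.sq (T.idem (J j \ J i)) := by
      apply Subtype.ext
      rw [one_smul, AddSubgroupClass.coe_sub, coe_sq_idem, coe_sq_idem, coe_sq_idem,
        sub_eq_iff_eq_add]
      exact (Finset.sum_sdiff hsub).symm
    rw [h1, absorbing_cone]
    exact T.sq_mem_coordFace_empty (T.idem_mem_upper _)
  · rintro ⟨ε, hε, h⟩
    rw [absorbing_cone] at h
    have hi : i.val < r := by have := j.2; have : i.val < j.val := hlt; omega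
    have h1 := T.diag_nonneg_of_mem h ⟨i.val, hi⟩
    rw [AddSubgroupClass.coe_sub, Submodule.coe_smul, coe_sq_idem, coe_sq_idem, sub_eq_add_neg,
      ← neg_smul, diag_add, diag_smul, diag_idem, diag_idem, if_neg (by simp [J]),
      if_pos (by simpa [J] using hlt)] at h1
    linarith

end Normed

/-- The rank is determined by the linear isomorphism class of the cone. -/
theorem rank_unique {r s : ℕ} {A B : Type*} [AddCommGroup A] [Module ℝ A] [FiniteDimensional ℝ A]
    [AddCommGroup B] [Module ℝ B] [FiniteDimensional ℝ B] (T : TAlgebra r A) (S : TAlgebra s B)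
    (φ : T.herm ≃ₗ[ℝ] S.herm) (h : φ '' T.cone = S.cone) : r = s := by
  -- Transport some norm to `A` and `B`; the statement does not depend on the choice.
  let a := (Module.finBasis ℝ A).equivFun
  let b := (Module.finBasis ℝ B).equivFun
  let nA : NormedAddCommGroup A := NormedAddCommGroup.induced A _ a.toLinearMap a.injective
  let nB : NormedAddCommGroup B := NormedAddCommGroup.induced B _ b.toLinearMap b.injective
  let sA : NormedSpace ℝ A := NormedSpace.induced ℝ A _ a.toLinearMap
  let sB : NormedSpace ℝ B := NormedSpace.induced ℝ B _ b.toLinearMap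
  have h' : φ.symm '' S.cone = T.cone := by
    rw [← h, Set.image_image]; simp
  exact le_antisymm (S.le_of_hasChain (T.hasChain_cone.of_equiv φ h))
    (T.le_of_hasChain (S.hasChain_cone.of_equiv φ.symm h'))

end TAlgebra

/-! ### Principal subalgebras as T-algebras -/

/-- A family of submodules is an internal direct sum if it is the family of images of a complete
system of orthogonal projections. -/
theorem isInternal_of_projections {ι M : Type*} [DecidableEq ι] [Fintype ι] [AddCommGroup M]
    [Module ℝ M] (G : ι → Submodule ℝ M) (π : ι → M →ₗ[ℝ] M) (hmem : ∀ p x, π p x ∈ G p)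
    (hself : ∀ p, ∀ x ∈ G p, π p x = x) (hne : ∀ p q, p ≠ q → ∀ x ∈ G p, π q x = 0)
    (hsum : ∀ x, ∑ p, π p x = x) : DirectSum.IsInternal G := by
  classical
  have hcoe : ∀ f : DirectSum ι fun p => G p,
      DirectSum.coeAddMonoidHom G f = ∑ p, (f p : M) := fun f => by
    rw [DirectSum.coeAddMonoidHom_eq_dfinsuppSum, DFinsupp.sum_eq_sum_fintype]
    · rfl
    · intro i; simp
  constructor
  · rw [injective_iff_map_eq_zero]
    intro f hf
    rw [hcoe] at hf
    refine DFinsupp.ext fun q => Subtype.ext ?_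
    have h := congrArg (π q) hf
    rw [map_sum, map_zero, Finset.sum_eq_single q (fun p _ hp => hne p q hp _ (f p).2)
      (by simp), hself q _ (f q).2] at h
    exact h
  · intro x
    refine ⟨∑ p, DirectSum.of (fun p => G p) p ⟨π p x, hmem p x⟩, ?_⟩
    simp only [map_sum, DirectSum.coeAddMonoidHom_of]
    exact hsum x

namespace TAlgebra

section Principal

variable {r : ℕ} {A : Type u} [AddCommGroup A] [Module ℝ A] (T : TAlgebra r A)

local notation:70 a:70 " ⋆ " b:71 => T.mul a b

variable {I : Finset (Fin r)}

theorem mul_mem_principalSubalgebra {a b : A} (ha : a ∈ T.principalSubalgebra I)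
    (hb : b ∈ T.principalSubalgebra I) : a ⋆ b ∈ T.principalSubalgebra I := by
  rw [mem_principalSubalgebra_iff] at *
  intro i hi
  rw [unit_mul_mul, mul_mul_unit, (ha i hi).1, (hb i hi).2]
  simp

theorem invol_mem_principalSubalgebra {a : A} (ha : a ∈ T.principalSubalgebra I) :
    T.invol a ∈ T.principalSubalgebra I := by
  rw [mem_principalSubalgebra_iff] at *
  intro i hi
  rw [← T.invol_unit, ← T.invol_mul, ← T.invol_mul, (ha i hi).1, (ha i hi).2, map_zero]
  simp

theorem block_mem_principalSubalgebra {a : A} (ha : a ∈ T.principalSubalgebra I) (i j : Fin r) :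
    T.block i j a ∈ T.principalSubalgebra I := by
  rw [mem_principalSubalgebra_iff] at *
  intro k hk
  rw [block_eq]
  constructor
  · by_cases h : k = i
    · subst h; simp [(ha k hk).1]
    · rw [unit_mul_mul, unit_mul_mul, T.unit_mul_unit_of_ne h]; simp
  · by_cases h : j = k
    · subst h
      rw [mul_mul_unit, unit_mul_unit_self, ← unit_mul_mul, (ha j hk).2, map_zero]
    · rw [mul_mul_unit, T.unit_mul_unit_of_ne h, map_zero]

theorem grade_le_principalSubalgebra {i j : Fin r} (hi : i ∉ I) (hj : j ∉ I) :
    T.grade i j ≤ T.principalSubalgebra I := by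
  intro a ha
  rw [mem_principalSubalgebra_iff]
  intro k hk
  exact ⟨T.unit_mul_of_ne (by rintro rfl; exact hi hk) ha,
    T.mul_unit_of_ne (by rintro rfl; exact hj hk) ha⟩

theorem block_eq_zero_left {a : A} (ha : a ∈ T.principalSubalgebra I) {i : Fin r} (hi : i ∈ I)
    (j : Fin r) : T.block i j a = 0 := by
  rw [block_eq, (T.mem_principalSubalgebra_iff.1 ha i hi).1, LinearMap.map_zero₂]

theorem block_eq_zero_right {a : A} (ha : a ∈ T.principalSubalgebra I) {j : Fin r} (hj : j ∈ I)
    (i : Fin r) : T.block i j a = 0 := by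
  rw [block_eq, ← unit_mul_mul, (T.mem_principalSubalgebra_iff.1 ha j hj).2, map_zero]

variable {n : ℕ} (e : Fin n ↪o Fin r)

/-- The projection of `A_I` onto the block with indices `e a`, `e b`. -/
def principalBlock (p : Fin n × Fin n) : T.principalSubalgebra I →ₗ[ℝ] T.principalSubalgebra I :=
  (T.block (e p.1) (e p.2)).restrict fun _ ha => T.block_mem_principalSubalgebra ha _ _

theorem coe_principalBlock (p : Fin n × Fin n) (x : T.principalSubalgebra I) :
    (T.principalBlock e p x : A) = T.block (e p.1) (e p.2) x := rfl

theorem sum_principalBlock (he : ∀ i, i ∈ Set.range e ↔ i ∉ I) (x : T.principalSubalgebra I) :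
    ∑ p : Fin n × Fin n, T.principalBlock e p x = x := by
  apply Subtype.ext
  rw [AddSubmonoidClass.coe_finsetSum]
  conv_rhs => rw [← T.sum_block (x : A)]
  refine Fintype.sum_of_injective (Prod.map e e) (e.injective.prodMap e.injective) _ _ ?_
    fun _ => rfl
  rintro ⟨i, j⟩ hij
  dsimp only
  by_cases hi : i ∈ I
  · exact T.block_eq_zero_left x.2 hi j
  by_cases hj : j ∈ I
  · exact T.block_eq_zero_right x.2 hj i
  obtain ⟨a, rfl⟩ := (he i).2 hi
  obtain ⟨b, rfl⟩ := (he j).2 hj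
  exact absurd ⟨(a, b), rfl⟩ hij

/-- The bigraded algebra `A_I`, its indices enumerated by the order embedding `e`. -/
def principalBigraded (he : ∀ i, i ∈ Set.range e ↔ i ∉ I) :
    BigradedAlgebra n (T.principalSubalgebra I) where
  mul := LinearMap.mk₂ ℝ (fun a b => ⟨T.mul a b, T.mul_mem_principalSubalgebra a.2 b.2⟩)
    (fun _ _ _ => Subtype.ext (by simp)) (fun _ _ _ => Subtype.ext (by simp))
    (fun _ _ _ => Subtype.ext (by simp)) (fun _ _ _ => Subtype.ext (by simp))
  grade a b := (T.grade (e a) (e b)).comap (T.principalSubalgebra I).subtype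
  isInternal := by
    refine isInternal_of_projections _ (T.principalBlock e) (fun p x => T.block_mem _ _ _)
      (fun p x hx => Subtype.ext (T.block_of_mem hx)) (fun p q hpq x hx => Subtype.ext ?_)
      (T.sum_principalBlock e he)
    refine T.block_of_mem_of_ne hx fun h => hpq ?_
    simp only [Prod.mk.injEq, e.injective.eq_iff] at h
    exact Prod.ext h.1 h.2
  mul_mem a b c x hx y hy := T.mul_mem _ _ _ _ hx _ hy
  mul_eq_zero a b c d h x hx y hy :=
    Subtype.ext (T.mul_eq_zero _ _ _ _ (fun h' => h (e.injective h')) _ hx _ hy)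

variable (he : ∀ i, i ∈ Set.range e ↔ i ∉ I)

theorem coe_principal_comp (a b : Fin n) (x : T.principalSubalgebra I) :
    (((T.principalBigraded e he).comp a b x : T.principalSubalgebra I) : A) =
      T.block (e a) (e b) x := by
  have hmem : ∀ p, T.principalBlock e p x ∈ (T.principalBigraded e he).grade p.1 p.2 :=
    fun p => T.block_mem _ _ _
  conv_lhs => rw [← T.sum_principalBlock e he x]
  rw [map_sum, AddSubmonoidClass.coe_finsetSum, Finset.sum_eq_single (a, b)]
  · rw [BigradedAlgebra.coe_comp_of_mem _ (hmem (a, b)), coe_principalBlock]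
  · rintro ⟨c, d⟩ _ h
    exact BigradedAlgebra.coe_comp_of_mem_of_ne _ (hmem (c, d)) h
  · simp

/-- The matrix algebra with involution `A_I`. -/
def principalInvolutive : InvolutiveBigradedAlgebra n (T.principalSubalgebra I) where
  toBigradedAlgebra := T.principalBigraded e he
  invol := T.invol.restrict fun _ ha => T.invol_mem_principalSubalgebra ha
  invol_invol a := Subtype.ext (T.invol_invol a)
  invol_mul a b := Subtype.ext (T.invol_mul a b)
  invol_grade a b := by
    apply le_antisymm
    · rintro _ ⟨x, hx, rfl⟩
      exact T.invol_mem hx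
    · intro x hx
      exact ⟨⟨T.invol x, T.invol_mem_principalSubalgebra x.2⟩, T.invol_mem hx,
        Subtype.ext (T.invol_invol x)⟩
  rho a := Submodule.comapSubtypeEquivOfLe (T.grade_le_principalSubalgebra
    ((he _).1 ⟨a, rfl⟩) ((he _).1 ⟨a, rfl⟩)) ≪≫ₗ T.rho (e a)
  rho_mul a x y := T.rho_mul (e a) ⟨x, x.2⟩ ⟨y, y.2⟩

theorem principal_diag (x : T.principalSubalgebra I) (a : Fin n) :
    (T.principalInvolutive e he).diag x a = T.diag x (e a) :=
  congrArg (T.rho (e a)) (Subtype.ext (T.coe_principal_comp e he a a x))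

theorem principal_trace (x : T.principalSubalgebra I) :
    (T.principalInvolutive e he).trace x = T.trace x := by
  unfold InvolutiveBigradedAlgebra.trace
  refine Fintype.sum_of_injective e e.injective _ _ (fun i hi => ?_)
    fun a => T.principal_diag e he x a
  rw [diag_eq_zero_iff]
  exact T.block_eq_zero_left x.2 (not_not.1 fun h => hi ((he i).2 h)) i

/-- The T-algebra `A_I`. -/
def principal : TAlgebra n (T.principalSubalgebra I) where
  toInvolutiveBigradedAlgebra := T.principalInvolutive e he
  unit_mul a b x hx := Subtype.ext (T.unit_mul _ _ _ hx)
  mul_unit a b x hx := Subtype.ext (T.mul_unit _ _ _ hx)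
  trace_mul_comm x y := by
    rw [principal_trace, principal_trace]; exact T.trace_mul_comm x y
  trace_mul_assoc x y z := by
    rw [principal_trace, principal_trace]; exact T.trace_mul_assoc x y z
  trace_mul_invol_nonneg x := by
    rw [principal_trace]; exact T.trace_mul_invol_nonneg x
  trace_mul_invol_eq_zero x := by
    rw [principal_trace]; exact (T.trace_mul_invol_eq_zero x).trans Submodule.coe_eq_zero
  mul_assoc_upper x y z i j k l hij hjk hkl := by
    have h := T.mul_assoc_upper x y z (e i) (e j) (e k) (e l) (e.monotone hij) (e.monotone hjk)
      (e.monotone hkl)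
    simp only [coe_comp, ← T.coe_principal_comp e he] at h
    exact Subtype.ext h
  mul_assoc_invol x y i j k l hij hjk hlk := by
    have h := T.mul_assoc_invol x y (e i) (e j) (e k) (e l) (e.monotone hij) (e.monotone hjk)
      (e.monotone hlk)
    simp only [coe_comp, ← T.coe_principal_comp e he] at h
    exact Subtype.ext h

/-- The embedding of `H(A_I)` into `H(A)`. -/
def principalEmbedding : (T.principal e he).herm →ₗ[ℝ] T.herm :=
  LinearMap.codRestrict T.herm
    ((T.principalSubalgebra I).subtype ∘ₗ (T.principal e he).herm.subtype)
    fun x => congrArg Subtype.val x.2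

theorem principalEmbedding_injective : Function.Injective (T.principalEmbedding e he) := by
  intro x y h
  exact Subtype.ext (Subtype.ext (congrArg (fun z : T.herm => (z : A)) h))

theorem principalEmbedding_mem_iff {x : (T.principal e he).herm} :
    T.principalEmbedding e he x ∈ T.principalCone I ↔ x ∈ (T.principal e he).cone := by
  have hUT : ∀ t : T.principalSubalgebra I, t ∈ (T.principal e he).upper ↔ (t : A) ∈ T.upper := by
    intro t
    have hb : ∀ a b, (T.principal e he).block a b t = 0 ↔ T.block (e a) (e b) t = 0 := fun a b => by
      rw [← T.coe_principal_comp e he, Submodule.coe_eq_zero]; rfl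
    simp only [mem_upper_iff, hb]
    constructor
    · intro h i j hij
      by_cases hi : i ∈ I
      · exact T.block_eq_zero_left t.2 hi j
      by_cases hj : j ∈ I
      · exact T.block_eq_zero_right t.2 hj i
      obtain ⟨a, rfl⟩ := (he i).2 hi
      obtain ⟨b, rfl⟩ := (he j).2 hj
      exact h a b (e.lt_iff_lt.1 hij)
    · exact fun h a b hab => h _ _ (e.lt_iff_lt.2 hab)
  constructor
  · rintro ⟨t, htI, ht, hpos, hx⟩
    refine ⟨⟨t, htI⟩, ⟨(hUT _).2 ht, fun a => ?_⟩, Subtype.ext hx⟩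
    exact (T.principal_diag e he ⟨t, htI⟩ a).symm ▸ hpos _ ((he _).1 ⟨a, rfl⟩)
  · rintro ⟨t, ⟨ht, hpos⟩, hx⟩
    refine ⟨t, t.2, (hUT _).1 ht, fun i hi => ?_, congrArg Subtype.val hx⟩
    obtain ⟨a, rfl⟩ := (he i).2 hi
    rw [← T.principal_diag e he]
    exact hpos a

theorem range_principalEmbedding :
    LinearMap.range (T.principalEmbedding e he) = Submodule.span ℝ (T.coordFace I) := by
  have hmem : ∀ x : T.herm, x ∈ LinearMap.range (T.principalEmbedding e he) ↔
      (x : A) ∈ T.principalSubalgebra I := fun x =>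
    ⟨by rintro ⟨y, rfl⟩; exact y.1.2, fun h => ⟨⟨⟨x, h⟩, Subtype.ext x.2⟩, rfl⟩⟩
  apply le_antisymm
  · intro x hx
    have hxI := T.mem_principalSubalgebra_iff.1 ((hmem x).1 hx)
    have hqx : T.quad (T.idem Iᶜ) x = x := by
      have h1 : T.idem Iᶜ ⋆ (x : A) = x :=
        T.idem_mul_eq_self fun i hi => (hxI i (by simpa using hi)).1
      have h2 : (x : A) ⋆ T.idem Iᶜ = x :=
        T.mul_idem_eq_self fun i hi => (hxI i (by simpa using hi)).2
      apply Subtype.ext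
      rw [coe_quad, invol_idem, h2, h1, ← idem_mul_mul, h1, h1, add_sub_cancel_right, invol_herm,
        ← two_smul ℝ, smul_smul]
      norm_num
    rw [← hqx]
    have h3 : Submodule.span ℝ {x | ∃ t ∈ T.upper, x = T.sq t} ≤
        (Submodule.span ℝ (T.coordFace I)).comap (T.quad (T.idem Iᶜ)) := by
      rw [Submodule.span_le]
      rintro _ ⟨t, ht, rfl⟩
      exact Submodule.subset_span (T.quad_idem_mem_coordFace I (T.sq_mem_coordFace_empty ht))
    rw [T.span_sq] at h3
    exact h3 trivial
  · rw [Submodule.span_le]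
    intro x hx
    obtain ⟨t, ht, htI, rfl⟩ := T.exists_isProper_of_mem hx
    rw [SetLike.mem_coe, hmem]
    have := T.mem_principalSubalgebra_iff.2 htI
    exact T.mul_mem_principalSubalgebra this (T.invol_mem_principalSubalgebra this)

end Principal
end TAlgebra

namespace TAlgebra

/-! ### Faces -/

section FaceData

variable {r : ℕ} {A : Type u} [AddCommGroup A] [Module ℝ A]

/-- The convex cone `F` is the preimage of a coordinate face under the triangular automorphism
`Q_u`, whose inverse is `Q_w`. -/
structure IsFaceData (T : TAlgebra r A) (F : Set T.herm) (I : Finset (Fin r)) (u w : A) :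
    Prop where
  u_mem : u ∈ T.UTpp
  w_mem : w ∈ T.UTpp
  w_mul_u : T.mul w u = T.idem Finset.univ
  u_mul_w : T.mul u w = T.idem Finset.univ
  mem_iff : ∀ x, x ∈ F ↔ T.quad u x ∈ T.coordFace I
  isConvexCone : IsConvexCone F

variable {T : TAlgebra r A} {F : Set T.herm} {I : Finset (Fin r)} {u w : A}

namespace IsFaceData

variable (h : T.IsFaceData F I u w)
include h

theorem quad_inv_quad (x : T.herm) : T.quad w (T.quad u x) = x := by
  rw [T.quad_quad h.w_mem.1 h.u_mem.1, h.w_mul_u, quad_one]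

theorem quad_quad_inv (x : T.herm) : T.quad u (T.quad w x) = x := by
  rw [T.quad_quad h.u_mem.1 h.w_mem.1, h.u_mul_w, quad_one]

theorem quad_conj {v : A} (hv : v ∈ T.UTpp) (x : T.herm) :
    T.quad (T.mul w (T.mul v u)) x = T.quad w (T.quad v (T.quad u x)) := by
  rw [T.quad_quad hv.1 h.u_mem.1, T.quad_quad h.w_mem.1 (T.mul_mem_upper hv.1 h.u_mem.1)]

theorem conj_mem {v : A} (hv : v ∈ T.UTpp) : T.mul w (T.mul v u) ∈ T.UTpp :=
  T.mul_mem_UTpp h.w_mem (T.mul_mem_UTpp hv h.u_mem)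

theorem eq_image : F = T.quad w '' T.coordFace I := by
  ext x
  rw [h.mem_iff]
  constructor
  · exact fun hx => ⟨_, hx, h.quad_inv_quad x⟩
  · rintro ⟨y, hy, rfl⟩; rwa [h.quad_quad_inv]

theorem image_eq : T.quad u '' F = T.coordFace I := by
  ext y
  constructor
  · rintro ⟨x, hx, rfl⟩; exact (h.mem_iff x).1 hx
  · intro hy; exact ⟨T.quad w y, (h.mem_iff _).2 (by rwa [h.quad_quad_inv]), h.quad_quad_inv y⟩

/-- The triangular automorphisms `Q_w Q_v Q_u`, with `v` fixing the coordinate face, preserve `F`.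
-/
theorem quad_conj_mem {v : A} (hv : v ∈ T.stab I) {x : T.herm} (hx : x ∈ F) :
    T.quad (T.mul w (T.mul v u)) x ∈ F := by
  rw [h.quad_conj hv.1, h.mem_iff, h.quad_quad_inv]
  exact T.quad_mem_coordFace hv ((h.mem_iff x).1 hx)

end IsFaceData

end FaceData

section Face

variable {r : ℕ} {A : Type u} [NormedAddCommGroup A] [NormedSpace ℝ A] [FiniteDimensional ℝ A]
  (T : TAlgebra r A)

local notation:70 a:70 " ⋆ " b:71 => T.mul a b

/-- Every face of the closed cone is mapped to a coordinate face by a triangular automorphism: for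
`t t*` in the relative interior of the face, with `t` proper, take `u` such that `u t` is an
idempotent. -/
theorem exists_image_face_eq {F : Set T.herm} (hF : IsConeFace F (T.coordFace ∅)) :
    ∃ (I : Finset (Fin r)) (u : A) (hu : u ∈ T.UTpp),
      T.quadEquiv u hu '' F = T.coordFace I := by
  classical
  obtain ⟨x, hx⟩ := hF.isConvexCone.exists_isOrderUnit hF.nonempty
  obtain ⟨t, ht, -, rfl⟩ := T.exists_isProper_of_mem (hF.subset hx.1)
  set I := Finset.univ.filter fun i => T.diag t i = 0
  have hI : ∀ i, i ∈ I ↔ T.diag t i = 0 := fun i => by simp [I]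
  obtain ⟨u, hu, hut⟩ := T.exists_mul_eq_idem ht hI
  refine ⟨I, u, hu, ?_⟩
  have hqt : T.quad u (T.sq t) = T.sq (T.idem Iᶜ) := by rw [T.quad_sq hu.1 ht.mem_upper, hut]
  have hE : IsOrderUnit (T.coordFace I) (T.sq (T.idem Iᶜ)) :=
    T.isOrderUnit_coordFace_iff.2
      (T.mem_principalCone_iff.2 ⟨_, T.idem_compl_mem_innerFactors I, rfl⟩)
  have hC := T.isConvexCone_coordFace ∅
  apply Set.Subset.antisymm
  · rintro _ ⟨y, hy, rfl⟩
    rw [quadEquiv_apply]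
    obtain ⟨ε, hε, h⟩ := hx.2 y hy
    have h1 := T.quad_mem_closed hu.1 (hF.subset hy)
    have h2 := T.quad_mem_closed hu.1 (hF.subset h)
    rw [map_sub, map_smul, hqt] at h2
    -- `Q_u y` lies below a multiple of an element of the coordinate face
    have h3 := ((T.isConeFace_coordFace I).mem_of_add_mem _ h2 _ (hC.smul_mem ε hε _ h1)
      (by rw [sub_add_cancel]; exact T.sq_idem_mem_coordFace I)).2
    have h4 := (T.isConvexCone_coordFace I).smul_mem ε⁻¹ (inv_pos.2 hε) _ h3
    rwa [inv_smul_smul₀ hε.ne'] at h4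
  · intro y hy
    obtain ⟨x, rfl⟩ := (T.quadEquiv u hu).surjective y
    refine ⟨x, ?_, rfl⟩
    rw [quadEquiv_apply] at hy
    obtain ⟨ε, hε, h⟩ := hE.2 _ hy
    rw [← hqt, ← map_smul, ← map_sub] at h
    have h1 := (T.quad_mem_iff hu).1 (T.coordFace_subset I h)
    have h2 := (T.quad_mem_iff hu).1 (T.coordFace_subset I hy)
    have h3 := (hF.mem_of_add_mem _ h1 _ (hC.smul_mem ε hε _ h2)
      (by rw [sub_add_cancel]; exact hx.1)).2
    have h4 := hF.isConvexCone.smul_mem ε⁻¹ (inv_pos.2 hε) _ h3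
    rwa [inv_smul_smul₀ hε.ne'] at h4

variable {T} {F : Set T.herm} {I : Finset (Fin r)} {u w : A}

namespace IsFaceData

variable (h : T.IsFaceData F I u w)
include h

theorem mem_intrinsicInterior_iff {x : T.herm} :
    x ∈ intrinsicInterior ℝ F ↔ ∃ s ∈ T.innerFactors I, T.quad u x = T.sq s := by
  rw [mem_intrinsicInterior_iff_isOrderUnit h.isConvexCone, ← mem_principalCone_iff,
    ← isOrderUnit_coordFace_iff]
  constructor
  · intro hx
    rw [← h.image_eq]; exact hx.image (T.quad u)
  · intro hx
    rw [← h.quad_inv_quad x, h.eq_image]; exact hx.image (T.quad w)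

theorem isProjectionallyExposed : IsProjectionallyExposed F (T.coordFace ∅) := by
  have hI := T.idem_mem_upper Iᶜ
  refine ⟨T.quad w ∘ₗ T.quad (T.idem Iᶜ) ∘ₗ T.quad u, ?_, ?_⟩
  · apply Set.Subset.antisymm
    · rintro _ ⟨x, hx, rfl⟩
      rw [h.mem_iff]
      simp only [LinearMap.comp_apply, h.quad_quad_inv]
      exact T.quad_idem_mem_coordFace I (T.quad_mem_closed h.u_mem.1 hx)
    · intro x hx
      have hx' := (h.mem_iff x).1 hx
      refine ⟨x, (T.quad_mem_iff h.u_mem).1 (T.coordFace_subset I hx'), ?_⟩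
      simp only [LinearMap.comp_apply, T.quad_idem_of_mem hx', h.quad_inv_quad]
  · have hII : T.idem Iᶜ ⋆ T.idem Iᶜ = T.idem Iᶜ :=
      T.idem_mul_eq_self fun i hi => by rw [unit_mul_idem, if_neg hi]
    refine LinearMap.ext fun x => ?_
    simp only [LinearMap.comp_apply, h.quad_quad_inv]
    rw [T.quad_quad hI hI, hII]

/-- If `Q_u x = s s*` with `s ∈ A_I` triangular and positive on the diagonal outside `I`, the proper
factor of `x` is `w s = u⁻¹ s`. -/
theorem existsUnique_isProper {x : T.herm} (hx : x ∈ intrinsicInterior ℝ F) :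
    (∃! t, T.IsProper t ∧ (x : A) = T.mul t (T.invol t)) ∧
      ∀ t, T.IsProper t → (x : A) = T.mul t (T.invol t) → ∀ i, i ∈ I ↔ T.diag t i = 0 := by
  obtain ⟨s, hs, hxs⟩ := h.mem_intrinsicInterior_iff.1 hx
  have hws := T.isProper_mul h.w_mem (T.isProper_of_mem_innerFactors hs)
  have hx : x = T.sq (w ⋆ s) := by
    rw [← T.quad_sq h.w_mem.1 hs.1, ← hxs, h.quad_inv_quad]
  have huniq : ∀ t, T.IsProper t → (x : A) = T.mul t (T.invol t) → t = w ⋆ s :=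
    fun t ht hxt => T.proper_unique ht hws ((Subtype.ext hxt).symm.trans hx)
  refine ⟨⟨w ⋆ s, ⟨hws, congrArg Subtype.val hx⟩, fun t ht => huniq t ht.1 ht.2⟩,
    fun t ht hxt i => ?_⟩
  rw [huniq t ht hxt, T.diag_mul h.w_mem.1 hs.1,
    ← T.diag_eq_zero_iff_of_mem_innerFactors hs i, mul_eq_zero,
    or_iff_right (h.w_mem.2 i).ne']

theorem image_quad_conj {v : A} (hv : v ∈ T.stab I) :
    T.quadEquiv _ (h.conj_mem hv.1) '' F = F := by
  apply Set.Subset.antisymm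
  · rintro _ ⟨x, hx, rfl⟩; exact h.quad_conj_mem hv hx
  · intro x hx
    obtain ⟨v', hv', h1, h2⟩ := T.exists_inv hv.1
    refine ⟨_, h.quad_conj_mem (T.inv_mem_stab hv hv' h1 h2) hx, ?_⟩
    rw [quadEquiv_apply, h.quad_conj hv', h.quad_conj hv.1, h.quad_quad_inv,
      T.quad_quad hv.1.1 hv'.1, h2, quad_one, h.quad_inv_quad]

theorem exists_quad_conj_eq {x y : T.herm} (hx : x ∈ intrinsicInterior ℝ F)
    (hy : y ∈ intrinsicInterior ℝ F) :
    ∃ v ∈ T.stab I, T.quad (w ⋆ (v ⋆ u)) x = y := by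
  obtain ⟨s, hs, hxs⟩ := h.mem_intrinsicInterior_iff.1 hx
  obtain ⟨s', hs', hys⟩ := h.mem_intrinsicInterior_iff.1 hy
  obtain ⟨v, hv, rfl⟩ := T.exists_mem_stab_mul_eq hs hs'
  refine ⟨v, hv, ?_⟩
  rw [h.quad_conj hv.1, hxs, T.quad_sq hv.1.1 hs.1, ← hys, h.quad_inv_quad]

theorem quad_conj_cancel {v v' : A} (hv : v ∈ T.stab I) (hv' : v' ∈ T.stab I) {x : T.herm}
    (hx : x ∈ intrinsicInterior ℝ F)
    (hvv : T.quad (w ⋆ (v ⋆ u)) x = T.quad (w ⋆ (v' ⋆ u)) x) : v = v' := by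
  obtain ⟨s, hs, hxs⟩ := h.mem_intrinsicInterior_iff.1 hx
  have h1 := congrArg (T.quad u) hvv
  rw [h.quad_conj hv.1, h.quad_conj hv'.1, h.quad_quad_inv, h.quad_quad_inv, hxs,
    T.quad_sq hv.1.1 hs.1, T.quad_sq hv'.1.1 hs.1] at h1
  exact T.mul_right_cancel_stab hv hv' hs (T.proper_unique
    (T.isProper_of_mem_innerFactors (T.mul_mem_innerFactors hv hs))
    (T.isProper_of_mem_innerFactors (T.mul_mem_innerFactors hv' hs)) h1)

theorem isHomogeneousCone : IsHomogeneousCone F where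
  isConvexCone := h.isConvexCone
  transitive x hx y hy := by
    obtain ⟨v, hv, hxy⟩ := h.exists_quad_conj_eq hx hy
    exact ⟨T.quadEquiv _ (h.conj_mem hv.1), h.image_quad_conj hv, hxy⟩

/-- The isomorphism of `H(A_I)` with `span F` is `Q_w`, preceded by the inclusion into `H(A)`. -/
theorem hasHomogeneousRank : HasHomogeneousRank F (r - I.card) := by
  have hcard : Iᶜ.card = r - I.card := by rw [Finset.card_compl, Fintype.card_fin]
  let e := Iᶜ.orderEmbOfFin hcard
  have he : ∀ i, i ∈ Set.range e ↔ i ∉ I := fun i => by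
    rw [Finset.range_orderEmbOfFin]; simp
  have hex : IsConeOfTAlgebraOfRank F (r - I.card) := by
    refine ⟨T.principalSubalgebra I, inferInstance, inferInstance, inferInstance,
      T.principal e he, ?_⟩
    let θ := T.quad w ∘ₗ T.principalEmbedding e he
    have hθ : Function.Injective θ := by
      refine Function.Injective.comp (g := T.quad w) ?_ (T.principalEmbedding_injective e he)
      exact fun a b hab => by rw [← h.quad_quad_inv a, hab, h.quad_quad_inv]
    have hrange : LinearMap.range θ = Submodule.span ℝ F := by
      rw [LinearMap.range_comp, range_principalEmbedding, Submodule.map_span, ← h.eq_image]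
    let φ := (LinearEquiv.ofInjective θ hθ ≪≫ₗ LinearEquiv.ofEq _ _ hrange).symm
    refine ⟨φ, ?_⟩
    have key : ∀ y, (φ.symm y : T.herm) ∈ intrinsicInterior ℝ F ↔ y ∈ (T.principal e he).cone := by
      intro y
      have : (φ.symm y : T.herm) = T.quad w (T.principalEmbedding e he y) := rfl
      rw [h.mem_intrinsicInterior_iff, this, h.quad_quad_inv, ← mem_principalCone_iff,
        principalEmbedding_mem_iff]
    ext y
    rw [← key]
    constructor
    · rintro ⟨x, hx, rfl⟩
      rwa [LinearEquiv.symm_apply_apply]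
    · exact fun hy => ⟨_, hy, φ.apply_symm_apply y⟩
  refine ⟨hex, fun s' hs' => ?_⟩
  obtain ⟨B, _, _, _, S, φ, hφ⟩ := hex
  obtain ⟨B', _, _, _, S', φ', hφ'⟩ := hs'
  refine S'.rank_unique S (φ'.symm ≪≫ₗ φ) ?_
  rw [← hφ, ← hφ', Set.image_image]
  simp

/-- The group of the restrictions to `span F` of the automorphisms `Q_w Q_v Q_u`, where `v` ranges
over the triangular group of `A_I`. -/
def group (h : T.IsFaceData F I u w) :
    Subgroup (Submodule.span ℝ F ≃ₗ[ℝ] Submodule.span ℝ F) where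
  carrier := {g | ∃ v ∈ T.stab I, ∀ x, (g x : T.herm) = T.quad (w ⋆ (v ⋆ u)) x}
  one_mem' := by
    refine ⟨_, T.one_mem_stab I, fun x => ?_⟩
    rw [idem_univ_mul, h.w_mul_u, quad_one]; rfl
  mul_mem' := by
    rintro g g' ⟨v, hv, hg⟩ ⟨v', hv', hg'⟩
    refine ⟨v ⋆ v', T.mul_mem_stab hv hv', fun x => ?_⟩
    rw [LinearEquiv.mul_apply, hg, hg', h.quad_conj hv.1, h.quad_conj hv'.1, h.quad_quad_inv,
      h.quad_conj (T.mul_mem_UTpp hv.1 hv'.1), T.quad_quad hv.1.1 hv'.1.1]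
  inv_mem' := by
    rintro g ⟨v, hv, hg⟩
    obtain ⟨v', hv', h1, h2⟩ := T.exists_inv hv.1
    refine ⟨v', T.inv_mem_stab hv hv' h1 h2, fun x => ?_⟩
    obtain ⟨y, rfl⟩ := g.surjective x
    rw [hg, h.quad_conj hv.1, h.quad_conj hv', h.quad_quad_inv, T.quad_quad hv'.1 hv.1.1, h1,
      quad_one, h.quad_inv_quad]
    exact congrArg Subtype.val (g.symm_apply_apply y)

theorem group_le : h.group ≤ coneAut {x : Submodule.span ℝ F | (x : T.herm) ∈ F} := by
  have key : ∀ g ∈ h.group, ∀ x : Submodule.span ℝ F, (x : T.herm) ∈ F → (g x : T.herm) ∈ F := by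
    rintro g ⟨v, hv, hg⟩ x hx
    rw [hg]; exact h.quad_conj_mem hv hx
  intro g hg
  change g '' _ = _
  apply Set.Subset.antisymm
  · rintro _ ⟨x, hx, rfl⟩; exact key g hg x hx
  · intro x hx
    exact ⟨g⁻¹ x, key _ (inv_mem hg) x hx, g.apply_symm_apply x⟩

theorem existsUnique_mem_group {x y : Submodule.span ℝ F}
    (hx : (x : T.herm) ∈ intrinsicInterior ℝ F) (hy : (y : T.herm) ∈ intrinsicInterior ℝ F) :
    ∃! g, g ∈ h.group ∧ g x = y := by
  obtain ⟨v, hv, hxy⟩ := h.exists_quad_conj_eq hx hy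
  have hmap : (Submodule.span ℝ F).map (T.quadEquiv _ (h.conj_mem hv.1)).toLinearMap =
      Submodule.span ℝ F := by
    rw [Submodule.map_span]
    exact congrArg _ (h.image_quad_conj hv)
  refine ⟨(T.quadEquiv _ (h.conj_mem hv.1)).ofSubmodules _ _ hmap,
    ⟨⟨v, hv, fun z => rfl⟩, Subtype.ext hxy⟩, ?_⟩
  rintro g ⟨⟨v', hv', hg⟩, hgx⟩
  have hvv : v' = v := h.quad_conj_cancel hv' hv hx (by rw [← hg, hgx, hxy])
  subst hvv
  exact LinearEquiv.ext fun z => Subtype.ext (hg z)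

end IsFaceData

end Face

end TAlgebra

theorem theorem3p5 {r : ℕ} {A : Type u} [NormedAddCommGroup A] [NormedSpace ℝ A]
    [FiniteDimensional ℝ A] (T : TAlgebra r A) (F : Set T.herm)
    (hF : IsConeFace F (closure T.cone)) (hproper : F ≠ closure T.cone) :
    -- (i)
    IsProjectionallyExposed F (closure T.cone) ∧
    -- (ii)
    (∃ s < r, IsHomogeneousCone F ∧ HasHomogeneousRank F s ∧
      ∃ I : Finset (Fin r), I.Nonempty ∧
        (∃ Q, T.IsTriangularAut Q ∧ Q '' F = closure (T.principalCone I)) ∧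
        (∀ x ∈ intrinsicInterior ℝ F,
          (∃! t, T.IsProper t ∧ (x : A) = T.mul t (T.invol t)) ∧
          ∀ t, T.IsProper t → (x : A) = T.mul t (T.invol t) →
            ∀ i, i ∈ I ↔ T.diag t i = 0) ∧
        s = r - I.card) ∧
    -- (iii)
    (∃ G : Subgroup (Submodule.span ℝ F ≃ₗ[ℝ] Submodule.span ℝ F),
      G ≤ coneAut {x : Submodule.span ℝ F | (x : T.herm) ∈ F} ∧
      (∀ x y : Submodule.span ℝ F, (x : T.herm) ∈ intrinsicInterior ℝ F →
        (y : T.herm) ∈ intrinsicInterior ℝ F → ∃! g, g ∈ G ∧ g x = y) ∧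
      ∀ g ∈ G, ∃ Q, T.IsTriangularAut Q ∧
        ∀ x : Submodule.span ℝ F, ((g x : Submodule.span ℝ F) : T.herm) = Q x) := by
  rw [T.closure_cone] at *
  obtain ⟨I, u, hu, himg⟩ := T.exists_image_face_eq hF
  obtain ⟨w, hw, hwu, huw⟩ := T.exists_inv hu
  have h : T.IsFaceData F I u w := ⟨hu, hw, hwu, huw, fun x => by
    rw [← himg]
    constructor
    · exact fun hx => ⟨x, hx, rfl⟩
    · rintro ⟨y, hy, hyx⟩
      rwa [← (T.quadEquiv u hu).injective hyx], hF.isConvexCone⟩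
  have hI : I.Nonempty := by
    by_contra hne
    rw [Finset.not_nonempty_iff_eq_empty] at hne
    subst hne
    exact hproper (Set.ext fun x => (h.mem_iff x).trans (T.quad_mem_iff hu))
  have hr : r - I.card < r := by
    have h1 := hI.card_pos
    have h2 : I.card ≤ r := (Finset.card_le_univ I).trans_eq (Fintype.card_fin r)
    omega
  refine ⟨h.isProjectionallyExposed, ⟨r - I.card, hr, h.isHomogeneousCone, h.hasHomogeneousRank,
    I, hI, ⟨T.quadEquiv u hu, T.isTriangularAut_quadEquiv u hu, ?_⟩,
    fun x hx => h.existsUnique_isProper hx, rfl⟩,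
    ⟨h.group, h.group_le, fun x y hx hy => h.existsUnique_mem_group hx hy, ?_⟩⟩
  · rw [himg, T.closure_principalCone]
  · rintro g ⟨v, hv, hg⟩
    exact ⟨T.quadEquiv _ (h.conj_mem hv.1), T.isTriangularAut_quadEquiv _ _, hg⟩

end
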